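/- Let $n\ge1$ and $k_1,k_2\ge0$ be integers. Identify the Heisenberg group $\mathbb{H}^n$ with $\mathbb{R}^{2n}\times\mathbb{R}$, with elements $(x,t)$, and let $$p_s(x,t)=\frac{1}{(4\pi)^n(2\pi)s^{n+1}}\int_{\mathbb{R}}e^{\frac{i}{s}\lambda t-\frac{|x|^2}{4s}|\lambda|\coth|\lambda|}\left(\frac{|\lambda|}{\sinh|\lambda|}\right)^n\,\mathrm{d}\lambda\qquad(s>0)$$ be its heat kernel. It is a smooth function of $R=|x|^2/4\in[0,\infty)$ and $|t|\in[0,\infty)$; put $$p_{1,k_1,k_2}(x,t)=\frac{\partial^{k_1}}{\partial R^{k_1}}\frac{\partial^{k_2}}{\partial|t|^{k_2}}p_1(x,t).$$ Let $\delta=\sqrt{\frac{R}{\pi|t|}}$ (for $t\neq0$) and $\kappa=2\sqrt{\pi|t|R}$. Let $\theta(y)=\frac{2y-\sin(2y)}{2\sin^2y}$ for $0<|y|<\pi$ and $\theta(0)=0$, so that $\theta$ is a bijection of $(-\pi,\pi)$ onto $\mathbb{R}$, and let $d(x,t)$ be the Carnot-Carathéodory distance of $(x,t)$ from the origin, that is,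 $d(x,t)=|x|\frac{y}{\sin y}$ with $y=\theta^{-1}(|t|/R)$ if $x\ne0$ and $t\ne0$, $d(x,0)=|x|$, and $d(0,t)=\sqrt{4\pi|t|}$. Finally let $I_\nu(z)=\sum_{k\ge0}\frac{z^{2k+\nu}}{2^{2k+\nu}\,k!\,\Gamma(k+\nu+1)}$ be the modified Bessel function. 1. Fix $C>1$. If $\delta\to0^+$ while $1/C\le\kappa\le C$, then $$p_{1,k_1,k_2}(x,t)=\frac{(-1)^{k_2}\pi^{k_1+k_2}}{4^n(\pi\delta)^{n+k_1-1}}\,e^{-\frac14d(x,t)^2}e^{-\kappa}I_{n+k_1-1}(\kappa)\,[1+O(\delta)].$$ That is, there are $\delta_0>0$ and $K$, depending only on $n,k_1,k_2,C$, such that for all $(x,t)$ with $\delta\le\delta_0$ and $1/C\le\kappa\le C$ the equality holds with a term $O(\delta)$ of modulus at most $K\delta$. 2. If $\kappa\to0^+$ and $|t|\to\infty$, then $$p_{1,k_1,k_2}(x,t)=\frac{(-1)^{k_2}\pi^{k_1+k_2}}{4^n(n+k_1-1)!}\,|t|^{n+k_1-1}e^{-\frac14d(x,t)^2}\left[1+O\left(\frac1{|t|}+\kappa\right)\right].$$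 That is, there are $\kappa_0>0$, $T>0$ and $K$, depending only on $n,k_1,k_2$, such that for all $(x,t)$ with $0\le\kappa\le\kappa_0$ and $|t|\ge T$ (points with $x=0$ included) the equality holds with a term $O\left(\frac1{|t|}+\kappa\right)$ of modulus at most $K\left(\frac1{|t|}+\kappa\right)$. -/

import Mathlib

open Set

noncomputable section

namespace Heisenberg

/-- The heat kernel `p_s(x,t)` of the Heisenberg group `ℍⁿ`, realized on `ℝ²ⁿ × ℝ` through the
exponential map (with sub-Laplacian `-∑ Xⱼ²`):
`p_s(x,t) = ((4π)ⁿ (2π) sⁿ⁺¹)⁻¹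
  ∫ exp(i λ t / s - |x|² |λ| coth|λ| / (4 s)) (|λ| / sinh|λ|)ⁿ dλ`.
(The value of the integrand at the single point `λ = 0` is irrelevant.) -/
def heatKernel (n : ℕ) (s : ℝ) (x : EuclideanSpace ℝ (Fin (2 * n))) (t : ℝ) : ℂ :=
  (1 / ((4 * Real.pi) ^ n * (2 * Real.pi) * s ^ (n + 1)) : ℝ) *
    ∫ l : ℝ,
      Complex.exp (Complex.I * ((l * t / s : ℝ) : ℂ)
          - ((‖x‖ ^ 2 / (4 * s) * (|l| * (Real.cosh |l| / Real.sinh |l|)) : ℝ) : ℂ)) *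
        (((|l| / Real.sinh |l|) ^ n : ℝ) : ℂ)

/-- The heat kernel as a function of the radial variables `R = |x|² / 4` and `r = |t|`. -/
def radialHeatKernel (n : ℕ) (s R r : ℝ) : ℂ :=
  (1 / ((4 * Real.pi) ^ n * (2 * Real.pi) * s ^ (n + 1)) : ℝ) *
    ∫ l : ℝ,
      Complex.exp (Complex.I * ((l * r / s : ℝ) : ℂ)
          - ((R / s * (|l| * (Real.cosh |l| / Real.sinh |l|)) : ℝ) : ℂ)) *
        (((|l| / Real.sinh |l|) ^ n : ℝ) : ℂ)

/-- The heat kernel depends only on `R = |x|² / 4` and `|t|`. -/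
theorem heatKernel_eq_radialHeatKernel (n : ℕ) (s : ℝ) (x : EuclideanSpace ℝ (Fin (2 * n)))
    (t : ℝ) : heatKernel n s x t = radialHeatKernel n s (‖x‖ ^ 2 / 4) |t| := by
  unfold heatKernel radialHeatKernel
  congr 1
  have hR : ‖x‖ ^ 2 / (4 * s) = ‖x‖ ^ 2 / 4 / s := by rw [div_div]
  rw [hR]
  rcases abs_choice t with h | h
  · rw [h]
  · rw [h, ← MeasureTheory.integral_neg_eq_self]
    simp only [abs_neg, neg_mul, mul_neg]

/-- The radial partial derivatives
`p_{s,k₁,k₂}(x,t) = ∂^{k₁}/∂R^{k₁} ∂^{k₂}/∂|t|^{k₂} p_s`, evaluated at `R = |x|² / 4` and `|t|`.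
The radial variables range over `[0,∞)`, and the derivatives are one-sided at the endpoint. -/
def radialDeriv (n : ℕ) (s : ℝ) (k₁ k₂ : ℕ) (x : EuclideanSpace ℝ (Fin (2 * n))) (t : ℝ) : ℂ :=
  iteratedDerivWithin k₁
    (fun R : ℝ => iteratedDerivWithin k₂ (fun r : ℝ => radialHeatKernel n s R r) (Ici 0) |t|)
    (Ici 0) (‖x‖ ^ 2 / 4)

/-- `θ(y) = (2y - sin 2y) / (2 sin² y)` for `y ≠ 0`, and `θ(0) = 0`; it maps `(-π, π)`
bijectively onto `ℝ`. -/
def theta (y : ℝ) : ℝ :=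
  if y = 0 then 0 else (2 * y - Real.sin (2 * y)) / (2 * Real.sin y ^ 2)

/-- `y_ω = θ⁻¹(ω) ∈ (-π, π)`. -/
def yOmega (ω : ℝ) : ℝ := Function.invFunOn theta (Ioo (-Real.pi) Real.pi) ω

/-- The Carnot-Carathéodory distance of `(x,t)` from the origin: `|x| y_ω / sin y_ω` with
`ω = |t| / R`, `R = |x|² / 4`, if `x ≠ 0` and `t ≠ 0`; `|x|` if `t = 0`; `√(4π|t|)` if `x = 0`. -/
def ccDist {n : ℕ} (x : EuclideanSpace ℝ (Fin (2 * n))) (t : ℝ) : ℝ :=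
  if t = 0 then ‖x‖
  else if x = 0 then Real.sqrt (4 * Real.pi * |t|)
  else ‖x‖ * (yOmega (|t| / (‖x‖ ^ 2 / 4)) / Real.sin (yOmega (|t| / (‖x‖ ^ 2 / 4))))

/-- `δ = √(R / (π |t|))`, where `R = |x|² / 4` (meaningful for `t ≠ 0`). -/
def deltaParam {n : ℕ} (x : EuclideanSpace ℝ (Fin (2 * n))) (t : ℝ) : ℝ :=
  Real.sqrt (‖x‖ ^ 2 / 4 / (Real.pi * |t|))

/-- `κ = 2 √(π |t| R)`, where `R = |x|² / 4`. -/
def kappaParam {n : ℕ} (x : EuclideanSpace ℝ (Fin (2 * n))) (t : ℝ) : ℝ :=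
  2 * Real.sqrt (Real.pi * |t| * (‖x‖ ^ 2 / 4))

/-- The modified Bessel function of the first kind, of order `ν ∈ ℕ`, on the real line:
`I_ν(z) = ∑ₖ z^{2k+ν} / (2^{2k+ν} k! Γ(k+ν+1))`. -/
def besselI (ν : ℕ) (z : ℝ) : ℝ :=
  ∑' k : ℕ, z ^ (2 * k + ν) / (2 ^ (2 * k + ν) * (Nat.factorial k : ℝ)
    * Real.Gamma ((k : ℝ) + (ν : ℝ) + 1))

/-- The leading term for `δ → 0⁺` with `κ` bounded and bounded away from `0`. -/
def leadingIII (n k₁ k₂ : ℕ) (x : EuclideanSpace ℝ (Fin (2 * n))) (t : ℝ) : ℝ :=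
  (-1) ^ k₂ * Real.pi ^ (k₁ + k₂) / (4 ^ n * (Real.pi * deltaParam x t) ^ (n + k₁ - 1))
    * Real.exp (-(ccDist x t ^ 2) / 4) * Real.exp (-kappaParam x t)
    * besselI (n + k₁ - 1) (kappaParam x t)

/-- The leading term for `κ → 0⁺` and `|t| → ∞`. -/
def leadingIV (n k₁ k₂ : ℕ) (x : EuclideanSpace ℝ (Fin (2 * n))) (t : ℝ) : ℝ :=
  (-1) ^ k₂ * Real.pi ^ (k₁ + k₂) / (4 ^ n * (Nat.factorial (n + k₁ - 1) : ℝ))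
    * |t| ^ (n + k₁ - 1) * Real.exp (-(ccDist x t ^ 2) / 4)

end Heisenberg

end

open Set

noncomputable section

namespace Heisenberg

open MeasureTheory Filter Topology

/-! Write r = |t|. Differentiating under the integral sign turns each radial derivative into the
line integral of a function that is holomorphic near the closed strip 0 ≤ Im z ≤ 3π/2 except at πi,
where the factor exp(-R z coth z) has in general an essential singularity. Moving the contour up to
Im z = 3π/2 costs only O(e^{-3πr/2}) and leaves an integral over a small square about πi
(`exists_norm_integral_integrand_sub_squareIntegral_le`).

Take the square of half-side 1/r and put z = πi + w/r. Since z coth z has a simple pole at πi with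
residue πi, the integrand becomes e^{-πr} r^{m+1} times a function of w that differs by O(1/r) from
a constant multiple of (iw)^{-(m+1)} exp(iw + a/(iw)), with m + 1 = n + k₁ and a = πrR = κ²/4
(`integrand_near_pole`, `exists_norm_exp_mul_sub_le`). Expanding exp(a/(iw)) and taking residues
gives 2π ∑ aᵏ/(k!(k+m)!), which is I_m(κ) up to the factor (κ/2)^m. This series is at least 1/m!, so
the absolute error O(1/r) is also a relative one (`exists_radialDeriv_one_eq`), uniformly for
bounded κ. Both regimes of the theorem have κ bounded and |t| large.

It remains to replace e^{-π|t|} by the distance. With y = π - e, the equation θ(y) = r/R yields d²/4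
= πr - κ + O(R) (`abs_ccDist_sq_add_kappaParam_sub_le`). Here R = κδ/2 = O(δ) in the first regime,
and R = O(1/|t|) in the second, where moreover κ is small and the Bessel series is its first term
1/m! up to O(κ). -/

/-! ### The function sinh z / z and its zeros. -/

/-- The entire function `sinh z / z`. -/
def shc : ℂ → ℂ := dslope Complex.sinh 0

theorem mul_shc (z : ℂ) : z * shc z = Complex.sinh z := by
  have := sub_smul_dslope Complex.sinh 0 z
  simpa [shc] using this

theorem shc_zero : shc 0 = 1 := by
  simp [shc, dslope_same]

theorem shc_of_ne {z : ℂ} (hz : z ≠ 0) : shc z = Complex.sinh z / z := by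
  rw [← mul_shc, mul_div_cancel_left₀ _ hz]

theorem differentiable_shc : Differentiable ℂ shc := by
  have := (Complex.differentiableOn_dslope (f := Complex.sinh) (c := 0) (s := univ)
    univ_mem).2 Complex.differentiable_sinh.differentiableOn
  exact differentiableOn_univ.1 this

theorem normSq_sinh (x y : ℝ) :
    ‖Complex.sinh (x + y * Complex.I)‖ ^ 2 = Real.sinh x ^ 2 + Real.sin y ^ 2 := by
  rw [← Complex.normSq_eq_norm_sq, Complex.sinh_add, Complex.sinh_mul_I, Complex.cosh_mul_I,
    Complex.normSq_apply]
  simp only [← Complex.ofReal_sinh, ← Complex.ofReal_cosh, ← Complex.ofReal_sin,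
    ← Complex.ofReal_cos, Complex.add_re, Complex.add_im, Complex.mul_re, Complex.mul_im,
    Complex.ofReal_re, Complex.ofReal_im, Complex.I_re, Complex.I_im]
  nlinarith [Real.sin_sq_add_cos_sq y, Real.cosh_sq x]

theorem normSq_cosh (x y : ℝ) :
    ‖Complex.cosh (x + y * Complex.I)‖ ^ 2 = Real.sinh x ^ 2 + Real.cos y ^ 2 := by
  rw [← Complex.normSq_eq_norm_sq, Complex.cosh_add, Complex.sinh_mul_I, Complex.cosh_mul_I,
    Complex.normSq_apply]
  simp only [← Complex.ofReal_sinh, ← Complex.ofReal_cosh, ← Complex.ofReal_sin,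
    ← Complex.ofReal_cos, Complex.add_re, Complex.add_im, Complex.mul_re, Complex.mul_im,
    Complex.ofReal_re, Complex.ofReal_im, Complex.I_re, Complex.I_im]
  nlinarith [Real.sin_sq_add_cos_sq y, Real.cosh_sq x]

/-- The zeros of sinh are the multiples of πi, by |sinh(x+iy)|² = sinh² x + sin² y. In this strip
only 0 and πi remain, and the zero at 0 has been divided out. -/
theorem shc_ne_zero {z : ℂ} (h0 : -Real.pi < z.im) (h1 : z.im < 2 * Real.pi)
    (h : z ≠ Real.pi * Complex.I) : shc z ≠ 0 := by
  rcases eq_or_ne z 0 with rfl | hz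
  · simp [shc_zero]
  rw [shc_of_ne hz]
  refine div_ne_zero (fun hs => ?_) hz
  have h2 := normSq_sinh z.re z.im
  rw [Complex.re_add_im, hs] at h2
  have h3 : Real.sinh z.re = 0 := by simp at h2; nlinarith [sq_nonneg (Real.sinh z.re), sq_nonneg (Real.sin z.im)]
  have h4 : Real.sin z.im = 0 := by simp at h2; nlinarith [sq_nonneg (Real.sinh z.re), sq_nonneg (Real.sin z.im)]
  rw [Real.sinh_eq_zero] at h3
  obtain ⟨k, hk⟩ := Real.sin_eq_zero_iff.1 h4
  have hp := Real.pi_pos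
  rw [← hk] at h0 h1
  have hk0 : (-1 : ℝ) < k := by nlinarith
  have hk1 : (k : ℝ) < 2 := by nlinarith
  have hk0' : (-1 : ℤ) < k := by exact_mod_cast hk0
  have hk1' : k < (2 : ℤ) := by exact_mod_cast hk1
  obtain rfl | rfl : k = 0 ∨ k = 1 := by omega
  · exact hz (Complex.ext h3 (by simpa using hk.symm))
  · exact h (Complex.ext (by simpa using h3) (by simpa using hk.symm))

theorem shc_ofReal_ne_zero (l : ℝ) : shc l ≠ 0 := by
  apply shc_ne_zero
  · simpa using Real.pi_pos
  · simpa using Real.pi_pos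
  · intro h
    have := congrArg Complex.im h
    simp [Real.pi_ne_zero.symm] at this

/-! ### The radial derivatives as integrals of a holomorphic function. -/

/-- The holomorphic integrand of the radial derivatives of the heat kernel. -/
def integrand (n k₁ k₂ : ℕ) (R r : ℝ) (z : ℂ) : ℂ :=
  Complex.exp (Complex.I * r * z - R * (Complex.cosh z / shc z)) *
    (-(Complex.cosh z / shc z)) ^ k₁ * (Complex.I * z) ^ k₂ * (shc z)⁻¹ ^ n

theorem differentiableAt_integrand (n k₁ k₂ : ℕ) (R r : ℝ) {z : ℂ} (hz : shc z ≠ 0) :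
    DifferentiableAt ℂ (integrand n k₁ k₂ R r) z := by
  have h1 := differentiable_shc z
  have h2 : DifferentiableAt ℂ (fun z => Complex.cosh z / shc z) z :=
    (Complex.differentiable_cosh z).fun_div h1 hz
  have h3 : DifferentiableAt ℂ (fun z => (shc z)⁻¹) z := h1.fun_inv hz
  unfold integrand
  fun_prop

theorem continuous_integrand_ofReal (n k₁ k₂ : ℕ) (R r : ℝ) :
    Continuous fun l : ℝ => integrand n k₁ k₂ R r l :=
  continuous_iff_continuousAt.2 fun l =>
    ContinuousAt.comp (f := Complex.ofReal)
      (differentiableAt_integrand n k₁ k₂ R r (shc_ofReal_ne_zero l)).continuousAt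
      Complex.continuous_ofReal.continuousAt

/-- Every domination below reduces to this integrable majorant. The number 5 exceeds 3π/2, so that 5
+ |x| bounds |x + iy| throughout the strip 0 ≤ y ≤ 3π/2. -/
theorem exists_pow_mul_exp_le (M : ℕ) :
    ∃ C : ℝ, 0 ≤ C ∧ ∀ x : ℝ, (5 + |x|) ^ M * Real.exp (-|x| / 2) ≤ C * (1 + x ^ 2)⁻¹ := by
  refine ⟨(M + 2).factorial * 2 ^ (M + 2) * Real.exp (5 / 2), by positivity, fun x => ?_⟩
  have hx := abs_nonneg x
  have h := Real.pow_div_factorial_le_exp (x := (5 + |x|) / 2) (by positivity) (M + 2)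
  rw [div_pow, div_div, div_le_iff₀ (by positivity)] at h
  rw [le_mul_inv_iff₀ (by positivity)]
  have h1 : 1 + x ^ 2 ≤ (5 + |x|) ^ 2 := by nlinarith [sq_abs x]
  have h2 : Real.exp ((5 + |x|) / 2) * Real.exp (-|x| / 2) = Real.exp (5 / 2) := by
    rw [← Real.exp_add]; ring_nf
  calc (5 + |x|) ^ M * Real.exp (-|x| / 2) * (1 + x ^ 2)
      ≤ (5 + |x|) ^ M * Real.exp (-|x| / 2) * (5 + |x|) ^ 2 := by gcongr
    _ = (5 + |x|) ^ (M + 2) * Real.exp (-|x| / 2) := by ring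
    _ ≤ Real.exp ((5 + |x|) / 2) * (2 ^ (M + 2) * (M + 2).factorial) * Real.exp (-|x| / 2) := by
        gcongr
    _ = _ := by rw [mul_right_comm, h2]; ring

theorem cosh_div_shc_ofReal {l : ℝ} (hl : l ≠ 0) :
    Complex.cosh l / shc l = ((|l| * (Real.cosh |l| / Real.sinh |l|) : ℝ) : ℂ) := by
  have h : |l| * (Real.cosh |l| / Real.sinh |l|) = l * (Real.cosh l / Real.sinh l) := by
    rcases abs_choice l with h | h <;> rw [h]
    simp [div_neg]
  rw [h, shc_of_ne (by exact_mod_cast hl)]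
  push_cast
  rw [div_div_eq_mul_div]; ring

theorem inv_shc_ofReal {l : ℝ} (hl : l ≠ 0) :
    (shc l)⁻¹ = ((|l| / Real.sinh |l| : ℝ) : ℂ) := by
  have h : |l| / Real.sinh |l| = l / Real.sinh l := by
    rcases abs_choice l with h | h <;> rw [h]
    simp [div_neg, neg_div]
  rw [h, shc_of_ne (by exact_mod_cast hl)]
  push_cast
  rw [inv_div]

theorem mul_coth_le {l : ℝ} (hl : 0 < l) : l * (Real.cosh l / Real.sinh l) ≤ 1 + l := by
  have hs : 0 < Real.sinh l := Real.sinh_pos_iff.2 hl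
  rw [← mul_div_assoc, div_le_iff₀ hs]
  have h1 : Real.cosh l = Real.sinh l + Real.exp (-l) := by
    rw [← Real.cosh_sub_sinh]; ring
  have h2 : Real.exp (-l) ≤ 1 := by simpa using hl.le
  have h3 := Real.self_le_sinh_iff.2 hl.le
  rw [h1]
  nlinarith

theorem div_sinh_le {l : ℝ} (hl : 0 < l) :
    l / Real.sinh l ≤ (1 + 2 * l) * Real.exp (-l) := by
  have hs : 0 < Real.sinh l := Real.sinh_pos_iff.2 hl
  rw [div_le_iff₀ hs, Real.sinh_eq]
  have h1 : Real.exp (-l) * Real.exp l = 1 := by rw [← Real.exp_add]; simp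
  have h2 : Real.exp (-l) ^ 2 * (1 + 2 * l) ≤ 1 := by
    have h3 := Real.add_one_le_exp (2 * l)
    have h4 : Real.exp (2 * l) = Real.exp l ^ 2 := by rw [← Real.exp_nat_mul]; simp
    rw [h4] at h3
    have : (Real.exp (-l) * Real.exp l) ^ 2 = 1 := by rw [h1]; simp
    nlinarith [sq_nonneg (Real.exp (-l))]
  nlinarith

/-- For R > -1/2 the exponential grows at most like e^{(1+|l|)/2}, which the decay e^{-|l|} of a
single factor l / sinh l beats; hence n ≥ 1. Negative R are admitted so that the derivative in R at
the endpoint R = 0 can be taken two-sided. -/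
theorem exists_norm_integrand_ofReal_le {n : ℕ} (hn : 0 < n) (k₁ k₂ : ℕ) :
    ∃ C : ℝ, 0 ≤ C ∧ ∀ R r l : ℝ, -(1 / 2) < R → l ≠ 0 →
      ‖integrand n k₁ k₂ R r l‖ ≤ C * (1 + l ^ 2)⁻¹ := by
  obtain ⟨C, hC, h⟩ := exists_pow_mul_exp_le (k₁ + k₂ + 1)
  refine ⟨2 * Real.exp (1 / 2) * C, by positivity, fun R r l hR hl => ?_⟩
  have hl' : 0 < |l| := abs_pos.2 hl
  set x := |l| with hx
  have hs : 0 < Real.sinh x := Real.sinh_pos_iff.2 hl'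
  have e1 := mul_coth_le hl'
  have e2 := div_sinh_le hl'
  have e3 : x / Real.sinh x ≤ 1 := (div_le_one hs).2 (Real.self_le_sinh_iff.2 hl'.le)
  set c := x * (Real.cosh x / Real.sinh x) with hc
  have hc0 : 0 ≤ c := by have := Real.cosh_pos x; positivity
  have e4 : (x / Real.sinh x) ^ n ≤ x / Real.sinh x := by
    simpa using pow_le_pow_of_le_one (by positivity) e3 hn
  rw [integrand, cosh_div_shc_ofReal hl, inv_shc_ofReal hl, norm_mul, norm_mul, norm_mul,
    Complex.norm_exp, norm_pow, norm_pow, norm_pow]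
  rw [← hx, ← hc]
  have e5 : (Complex.I * r * l - R * (c : ℂ)).re = -(R * c) := by simp
  rw [e5]
  simp only [norm_neg, norm_mul, Complex.norm_I, one_mul, Complex.norm_real, Real.norm_eq_abs,
    abs_of_nonneg hc0, abs_of_nonneg (show 0 ≤ x / Real.sinh x by positivity)]
  rw [← hx]
  have e6 : -(R * c) ≤ (1 + x) / 2 := by nlinarith
  calc Real.exp (-(R * c)) * c ^ k₁ * x ^ k₂ * (x / Real.sinh x) ^ n
      ≤ Real.exp ((1 + x) / 2) * (5 + x) ^ k₁ * (5 + x) ^ k₂ * (2 * (5 + x) * Real.exp (-x)) := by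
        gcongr
        · linarith
        · linarith
        · refine e4.trans (e2.trans ?_)
          gcongr
          linarith
    _ = 2 * Real.exp (1 / 2) * ((5 + x) ^ (k₁ + k₂ + 1) * Real.exp (-x / 2)) := by
        have : Real.exp ((1 + x) / 2) * Real.exp (-x) = Real.exp (1 / 2) * Real.exp (-x / 2) := by
          rw [← Real.exp_add, ← Real.exp_add]; ring_nf
        calc _ = 2 * (5 + x) ^ (k₁ + k₂ + 1) * (Real.exp ((1 + x) / 2) * Real.exp (-x)) := by ring
          _ = _ := by rw [this]; ring
    _ ≤ 2 * Real.exp (1 / 2) * (C * (1 + l ^ 2)⁻¹) :=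
        mul_le_mul_of_nonneg_left (h l) (by positivity)
    _ = _ := by ring

theorem ae_ne_zero : ∀ᵐ l : ℝ, l ≠ 0 := by
  simp [ae_iff]

theorem integrable_integrand_ofReal {n : ℕ} (hn : 0 < n) (k₁ k₂ : ℕ) {R : ℝ}
    (hR : -(1 / 2) < R) (r : ℝ) : Integrable fun l : ℝ => integrand n k₁ k₂ R r l := by
  obtain ⟨C, hC, h⟩ := exists_norm_integrand_ofReal_le hn k₁ k₂
  refine (integrable_inv_one_add_sq.const_mul C).mono'
    (continuous_integrand_ofReal n k₁ k₂ R r).aestronglyMeasurable ?_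
  filter_upwards [ae_ne_zero] with l hl using h R r l hR hl

theorem hasDerivAt_integral_integrand_right {n : ℕ} (hn : 0 < n) (k₁ k₂ : ℕ) {R : ℝ}
    (hR : -(1 / 2) < R) (r : ℝ) :
    HasDerivAt (fun r => ∫ l : ℝ, integrand n k₁ k₂ R r l)
      (∫ l : ℝ, integrand n k₁ (k₂ + 1) R r l) r := by
  obtain ⟨C, hC, h⟩ := exists_norm_integrand_ofReal_le hn k₁ (k₂ + 1)
  refine (hasDerivAt_integral_of_dominated_loc_of_deriv_le (s := univ) univ_mem
    (F := fun r (l : ℝ) => integrand n k₁ k₂ R r l)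
    (F' := fun r (l : ℝ) => integrand n k₁ (k₂ + 1) R r l)
    (Eventually.of_forall fun r => (continuous_integrand_ofReal n k₁ k₂ R r).aestronglyMeasurable)
    (integrable_integrand_ofReal hn k₁ k₂ hR r)
    (continuous_integrand_ofReal n k₁ (k₂ + 1) R r).aestronglyMeasurable
    (bound := fun l => C * (1 + l ^ 2)⁻¹) ?_ (integrable_inv_one_add_sq.const_mul C) ?_).2
  · filter_upwards [ae_ne_zero] with l hl r _ using h R r l hR hl
  · refine Eventually.of_forall fun l r _ => ?_
    have h1 : HasDerivAt (fun r : ℝ => Complex.I * r * l - R * (Complex.cosh l / shc l))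
        (Complex.I * l) r := by
      have := (((hasDerivAt_id r).ofReal_comp.const_mul Complex.I).mul_const (l : ℂ)).sub_const
        (R * (Complex.cosh l / shc l))
      simpa using this
    have h2 := (((h1.cexp).mul_const ((-(Complex.cosh l / shc l)) ^ k₁)).mul_const
      ((Complex.I * l) ^ k₂)).mul_const ((shc l)⁻¹ ^ n)
    refine h2.congr_deriv ?_
    simp only [integrand]
    ring

theorem hasDerivAt_integral_integrand_left {n : ℕ} (hn : 0 < n) (k₁ k₂ : ℕ) {R : ℝ}
    (hR : -(1 / 2) < R) (r : ℝ) :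
    HasDerivAt (fun R => ∫ l : ℝ, integrand n k₁ k₂ R r l)
      (∫ l : ℝ, integrand n (k₁ + 1) k₂ R r l) R := by
  obtain ⟨C, hC, h⟩ := exists_norm_integrand_ofReal_le hn (k₁ + 1) k₂
  refine (hasDerivAt_integral_of_dominated_loc_of_deriv_le (Ioi_mem_nhds hR)
    (F := fun R (l : ℝ) => integrand n k₁ k₂ R r l)
    (F' := fun R (l : ℝ) => integrand n (k₁ + 1) k₂ R r l)
    (Eventually.of_forall fun R => (continuous_integrand_ofReal n k₁ k₂ R r).aestronglyMeasurable)
    (integrable_integrand_ofReal hn k₁ k₂ hR r)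
    (continuous_integrand_ofReal n (k₁ + 1) k₂ R r).aestronglyMeasurable
    (bound := fun l => C * (1 + l ^ 2)⁻¹) ?_ (integrable_inv_one_add_sq.const_mul C) ?_).2
  · filter_upwards [ae_ne_zero] with l hl R hR using h R r l hR hl
  · refine Eventually.of_forall fun l R _ => ?_
    have h1 : HasDerivAt (fun R : ℝ => Complex.I * r * l - R * (Complex.cosh l / shc l))
        (-(Complex.cosh l / shc l)) R := by
      have := (((hasDerivAt_id R).ofReal_comp.mul_const (Complex.cosh l / shc l))).const_sub
        (Complex.I * r * l)
      simpa using this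
    have h2 := (((h1.cexp).mul_const ((-(Complex.cosh l / shc l)) ^ k₁)).mul_const
      ((Complex.I * l) ^ k₂)).mul_const ((shc l)⁻¹ ^ n)
    refine h2.congr_deriv ?_
    simp only [integrand]
    ring

/-- Ordinary derivatives at every point of [0,∞), including the endpoint, determine the one-sided
ones because [0,∞) has unique derivatives. -/
theorem iteratedDerivWithin_Ici_of_hasDerivAt {G : ℕ → ℝ → ℂ}
    (h : ∀ k, ∀ x, 0 ≤ x → HasDerivAt (G k) (G (k + 1) x) x) (k : ℕ) {x : ℝ} (hx : 0 ≤ x) :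
    iteratedDerivWithin k (G 0) (Ici 0) x = G k x := by
  induction k generalizing x with
  | zero => simp
  | succ k ih =>
    rw [iteratedDerivWithin_succ,
      derivWithin_congr (s := Ici 0) (fun y hy => ih (mem_Ici.1 hy)) (ih hx)]
    exact (h k x hx).hasDerivWithinAt.derivWithin (uniqueDiffOn_Ici 0 x hx)

theorem radialHeatKernel_one_eq (n : ℕ) (R r : ℝ) :
    radialHeatKernel n 1 R r = (1 / ((4 * Real.pi) ^ n * (2 * Real.pi)) : ℝ) *
      ∫ l : ℝ, integrand n 0 0 R r l := by
  rw [radialHeatKernel, one_pow, mul_one]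
  congr 1
  refine integral_congr_ae ?_
  filter_upwards [ae_ne_zero] with l hl
  rw [integrand, cosh_div_shc_ofReal hl, inv_shc_ofReal hl]
  push_cast
  simp only [div_one, pow_zero, mul_one]
  ring_nf

theorem radialDeriv_one_eq {n : ℕ} (hn : 0 < n) (k₁ k₂ : ℕ) (x : EuclideanSpace ℝ (Fin (2 * n)))
    (t : ℝ) :
    radialDeriv n 1 k₁ k₂ x t = (1 / ((4 * Real.pi) ^ n * (2 * Real.pi)) : ℝ) *
      ∫ l : ℝ, integrand n k₁ k₂ (‖x‖ ^ 2 / 4) |t| l := by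
  set c : ℂ := ((1 / ((4 * Real.pi) ^ n * (2 * Real.pi)) : ℝ) : ℂ)
  have h1 : ∀ R : ℝ, 0 ≤ R →
      iteratedDerivWithin k₂ (fun r : ℝ => radialHeatKernel n 1 R r) (Ici 0) |t| =
        c * ∫ l : ℝ, integrand n 0 k₂ R |t| l := by
    intro R hR
    have := iteratedDerivWithin_Ici_of_hasDerivAt
      (G := fun k r => c * ∫ l : ℝ, integrand n 0 k R r l)
      (fun k r _ => (hasDerivAt_integral_integrand_right hn 0 k (by linarith) r).const_mul c)
      k₂ (abs_nonneg t)
    simpa only [radialHeatKernel_one_eq] using this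
  rw [radialDeriv]
  have hx : 0 ≤ ‖x‖ ^ 2 / 4 := by positivity
  rw [iteratedDerivWithin_congr (s := Ici 0) (fun R hR => h1 R (mem_Ici.1 hR)) (mem_Ici.2 hx)]
  exact iteratedDerivWithin_Ici_of_hasDerivAt
      (G := fun k R => c * ∫ l : ℝ, integrand n k k₂ R |t| l)
      (fun k R hR => (hasDerivAt_integral_integrand_left hn k k₂ (by linarith) |t|).const_mul c)
      k₁ hx

/-! ### Moving the contour across an isolated singularity. -/

/-- The integral over the boundary of the square `[-1,1]²`, counterclockwise. -/
def squareIntegral (f : ℂ → ℂ) : ℂ :=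
  (∫ x : ℝ in (-1)..1, f (x - Complex.I)) - (∫ x : ℝ in (-1)..1, f (x + Complex.I)) +
    Complex.I * (∫ y : ℝ in (-1)..1, f (1 + y * Complex.I)) -
    Complex.I * (∫ y : ℝ in (-1)..1, f (-1 + y * Complex.I))

theorem continuous_horizontal (y : ℝ) : Continuous fun x : ℝ => (x + y * Complex.I : ℂ) := by
  fun_prop

theorem continuous_vertical (x : ℝ) : Continuous fun y : ℝ => (x + y * Complex.I : ℂ) := by
  fun_prop

/-- The boundary integral over a rectangle of a function which is holomorphic in the rectangle
except at one point is the integral over a small square about that point. -/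
theorem rectangle_boundary_eq_squareIntegral {f : ℂ → ℂ} {b c h L : ℝ} (hh : 0 < h) (hc : h < c)
    (hb : c + h < b) (hL : h < L)
    (hf : ∀ z : ℂ, 0 ≤ z.im → z.im ≤ b → z ≠ c * Complex.I → DifferentiableAt ℂ f z) :
    (∫ x : ℝ in (-L)..L, f x) - (∫ x : ℝ in (-L)..L, f (x + b * Complex.I)) +
      Complex.I * (∫ y : ℝ in (0 : ℝ)..b, f (L + y * Complex.I)) -
      Complex.I * (∫ y : ℝ in (0 : ℝ)..b, f ((-L : ℝ) + y * Complex.I)) =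
    h * squareIntegral fun w => f (c * Complex.I + h * w) := by
  have hne : ∀ x y : ℝ, x ≠ 0 ∨ y ≠ c → (x + y * Complex.I : ℂ) ≠ c * Complex.I := by
    intro x y hxy he
    have h1 := congrArg Complex.re he
    have h2 := congrArg Complex.im he
    simp at h1 h2
    tauto
  have hor : ∀ y : ℝ, 0 ≤ y → y ≤ b → y ≠ c → ∀ p q : ℝ,
      IntervalIntegrable (fun x : ℝ => f (x + y * Complex.I)) volume p q := by
    intro y h0 h1 h2 p q
    refine Continuous.intervalIntegrable (continuous_iff_continuousAt.2 fun x => ?_) p q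
    exact ContinuousAt.comp (f := fun x : ℝ => (x + y * Complex.I : ℂ))
      (hf _ (by simpa) (by simpa) (hne _ _ (Or.inr h2))).continuousAt
      (continuous_horizontal y).continuousAt
  have ver : ∀ x : ℝ, x ≠ 0 → ∀ p q : ℝ, 0 ≤ p → p ≤ q → q ≤ b →
      IntervalIntegrable (fun y : ℝ => f (x + y * Complex.I)) volume p q := by
    intro x hx p q hp hpq hq
    refine ContinuousOn.intervalIntegrable_of_Icc hpq fun y hy => ?_
    exact (ContinuousAt.comp (f := fun y : ℝ => (x + y * Complex.I : ℂ))
      (hf _ (by simpa using hp.trans hy.1) (by simpa using hy.2.trans hq)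
        (hne _ _ (Or.inl hx))).continuousAt
      (continuous_vertical x).continuousAt).continuousWithinAt
  have rect : ∀ p q u v : ℝ, p ≤ q → u ≤ v → 0 ≤ u → v ≤ b →
      (∀ x y : ℝ, p ≤ x → x ≤ q → u ≤ y → y ≤ v → x ≠ 0 ∨ y ≠ c) →
      (∫ x : ℝ in p..q, f (x + u * Complex.I)) - (∫ x : ℝ in p..q, f (x + v * Complex.I)) +
        Complex.I * (∫ y : ℝ in u..v, f (q + y * Complex.I)) -
        Complex.I * (∫ y : ℝ in u..v, f (p + y * Complex.I)) = 0 := by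
    intro p q u v hpq huv hu hv hav
    have := Complex.integral_boundary_rect_eq_zero_of_differentiableOn f (p + u * Complex.I)
      (q + v * Complex.I) ?_
    · simpa using this
    · intro z hz
      simp [Complex.mem_reProdIm, uIcc_of_le hpq, uIcc_of_le huv] at hz
      refine (hf z (hu.trans hz.2.1) (hz.2.2.trans hv) ?_).differentiableWithinAt
      rw [← Complex.re_add_im z]
      exact hne _ _ (hav _ _ hz.1.1 hz.1.2 hz.2.1 hz.2.2)
  -- The complement of the square in the large rectangle is cut into four rectangles, below, above,
  -- left and right, each avoiding the singularity; Cauchy's theorem applies to each.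
  have r1 := rect (-L) L 0 (c - h) (by linarith) (by linarith) le_rfl (by linarith)
    (fun x y _ _ _ hy => Or.inr (by linarith))
  have r2 := rect (-L) L (c + h) b (by linarith) (by linarith) (by linarith) le_rfl
    (fun x y _ _ hy _ => Or.inr (by linarith))
  have r3 := rect (-L) (-h) (c - h) (c + h) (by linarith) (by linarith) (by linarith) (by linarith)
    (fun x y _ hx _ _ => Or.inl (by linarith))
  have r4 := rect h L (c - h) (c + h) (by linarith) (by linarith) (by linarith) (by linarith)
    (fun x y hx _ _ _ => Or.inl (by linarith))
  have s1 : ∀ y : ℝ, 0 ≤ y → y ≤ b → y ≠ c →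
      (∫ x : ℝ in (-L)..L, f (x + y * Complex.I)) = (∫ x : ℝ in (-L)..(-h), f (x + y * Complex.I))
        + (∫ x : ℝ in (-h)..h, f (x + y * Complex.I)) + ∫ x : ℝ in h..L, f (x + y * Complex.I) := by
    intro y h0 h1 h2
    rw [intervalIntegral.integral_add_adjacent_intervals (hor y h0 h1 h2 _ _) (hor y h0 h1 h2 _ _),
      intervalIntegral.integral_add_adjacent_intervals (hor y h0 h1 h2 _ _) (hor y h0 h1 h2 _ _)]
  have s2 : ∀ x : ℝ, x ≠ 0 →
      (∫ y : ℝ in (0 : ℝ)..b, f (x + y * Complex.I)) =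
        (∫ y : ℝ in (0 : ℝ)..(c - h), f (x + y * Complex.I))
        + (∫ y : ℝ in (c - h)..(c + h), f (x + y * Complex.I)) +
        ∫ y : ℝ in (c + h)..b, f (x + y * Complex.I) := by
    intro x hx
    have i1 := ver x hx 0 (c - h) le_rfl (by linarith) (by linarith)
    have i2 := ver x hx (c - h) (c + h) (by linarith) (by linarith) (by linarith)
    have i3 := ver x hx (c + h) b (by linarith) (by linarith) (by linarith)
    rw [intervalIntegral.integral_add_adjacent_intervals i1 i2,
      intervalIntegral.integral_add_adjacent_intervals (i1.trans i2) i3]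
  -- Rescaling identifies the sides of the square of half-side h about ci with those of [-1,1]².
  have t1 : ∀ s : ℝ, (h : ℂ) * (∫ x : ℝ in (-1)..1, f (c * Complex.I + h * (x + s * Complex.I))) =
      ∫ x : ℝ in (-h)..h, f (x + (c + h * s : ℝ) * Complex.I) := by
    intro s
    have := intervalIntegral.smul_integral_comp_mul_right (a := -1) (b := 1)
      (fun x : ℝ => f (x + (c + h * s : ℝ) * Complex.I)) h
    simp only [neg_mul, one_mul] at this
    rw [← this, Complex.real_smul]
    congr 2
    ext x
    push_cast
    ring_nf
  have t2 : ∀ s : ℝ, (h : ℂ) * (∫ y : ℝ in (-1)..1, f (c * Complex.I + h * (s + y * Complex.I))) =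
      ∫ y : ℝ in (c - h)..(c + h), f ((h * s : ℝ) + y * Complex.I) := by
    intro s
    have := intervalIntegral.smul_integral_comp_mul_add (a := -1) (b := 1)
      (fun y : ℝ => f ((h * s : ℝ) + y * Complex.I)) h c
    rw [show h * -1 + c = c - h by ring, show h * 1 + c = c + h by ring] at this
    rw [← this, Complex.real_smul]
    congr 2
    ext x
    push_cast
    ring_nf
  have u1 := t1 (-1)
  have u2 := t1 1
  have u3 := t2 1
  have u4 := t2 (-1)
  simp only [mul_neg, mul_one, ← sub_eq_add_neg] at u1 u2 u3 u4
  rw [s1 (c - h) (by linarith) (by linarith) (by linarith)] at r1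
  rw [s1 (c + h) (by linarith) (by linarith) (by linarith)] at r2
  rw [s2 L (by linarith), s2 (-L) (by linarith)]
  simp only [Complex.ofReal_neg, Complex.ofReal_one, neg_mul, one_mul, Complex.ofReal_zero,
    zero_mul, add_zero, ← sub_eq_add_neg] at r1 r2 r3 r4 u1 u2 u3 u4 ⊢
  rw [squareIntegral]
  linear_combination r1 + r2 + r3 + r4 - u1 + u2 - Complex.I * u3 + Complex.I * u4

/-- The contour of integration is moved across an isolated singularity. -/
theorem integral_line_sub_integral_line_eq_squareIntegral {f : ℂ → ℂ} {b c h C : ℝ} (hh : 0 < h)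
    (hc : h < c) (hb : c + h < b)
    (hf : ∀ z : ℂ, 0 ≤ z.im → z.im ≤ b → z ≠ c * Complex.I → DifferentiableAt ℂ f z)
    (hbound : ∀ x y : ℝ, 1 ≤ |x| → 0 ≤ y → y ≤ b →
      ‖f (x + y * Complex.I)‖ ≤ C * (1 + x ^ 2)⁻¹)
    (h0 : Integrable fun x : ℝ => f x) (h1 : Integrable fun x : ℝ => f (x + b * Complex.I)) :
    (∫ x : ℝ, f x) - (∫ x : ℝ, f (x + b * Complex.I)) =
      h * squareIntegral fun w => f (c * Complex.I + h * w) := by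
  have l0 := intervalIntegral_tendsto_integral h0 tendsto_neg_atTop_atBot tendsto_id
  have l1 := intervalIntegral_tendsto_integral h1 tendsto_neg_atTop_atBot tendsto_id
  have hz : Tendsto (fun L : ℝ => C * (1 + L ^ 2)⁻¹ * |b - 0|) atTop (𝓝 0) := by
    have : Tendsto (fun L : ℝ => (1 + L ^ 2)⁻¹) atTop (𝓝 0) :=
      (tendsto_atTop_add_const_left _ _ (tendsto_pow_atTop two_ne_zero)).inv_tendsto_atTop
    simpa using (this.const_mul C).mul_const |b - 0|
  have side : ∀ s : ℝ → ℝ, (∀ L, |s L| = |L|) →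
      Tendsto (fun L : ℝ => ∫ y : ℝ in (0 : ℝ)..b, f (s L + y * Complex.I)) atTop (𝓝 0) := by
    intro s hs
    refine squeeze_zero_norm' ?_ hz
    filter_upwards [eventually_ge_atTop 1] with L hL
    refine intervalIntegral.norm_integral_le_of_norm_le_const fun y hy => ?_
    rw [uIoc_of_le (by linarith)] at hy
    have hsL : s L ^ 2 = L ^ 2 := by rw [← sq_abs, hs, sq_abs]
    rw [← hsL]
    exact hbound _ _ (by rw [hs]; exact hL.trans (le_abs_self L)) hy.1.le hy.2
  have l2 := side id fun L => rfl
  have l3 := side Neg.neg fun L => abs_neg L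
  have lim := (((l0.sub l1).add (l2.const_mul Complex.I)).sub (l3.const_mul Complex.I))
  have const : Tendsto (fun _ : ℝ => (h : ℂ) * squareIntegral fun w => f (c * Complex.I + h * w))
      atTop (𝓝 (h * squareIntegral fun w => f (c * Complex.I + h * w))) := tendsto_const_nhds
  simp only [mul_zero, add_zero, sub_zero] at lim
  -- The boundary integral does not depend on L once L > h, so it equals its limit.
  refine tendsto_nhds_unique lim (const.congr' ?_)
  filter_upwards [eventually_gt_atTop h] with L hL
  exact (rectangle_boundary_eq_squareIntegral hh hc hb hL hf).symm

/-! ### Bounds in the strip and on the shifted line. -/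

theorem norm_add_mul_I_le {x y : ℝ} (hy : 0 ≤ y) (hy' : y ≤ 3 / 2 * Real.pi) :
    ‖(x + y * Complex.I : ℂ)‖ ≤ 5 + |x| := by
  refine (norm_add_le _ _).trans ?_
  have := Real.pi_lt_d2
  rw [norm_mul, Complex.norm_I, Complex.norm_real, Complex.norm_real, Real.norm_eq_abs,
    Real.norm_eq_abs, abs_of_nonneg hy]
  linarith

theorem cosh_div_shc {z : ℂ} (hz : z ≠ 0) :
    Complex.cosh z / shc z = z * (Complex.cosh z / Complex.sinh z) := by
  rw [shc_of_ne hz, div_div_eq_mul_div]; ring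

theorem inv_shc {z : ℂ} (hz : z ≠ 0) : (shc z)⁻¹ = z / Complex.sinh z := by
  rw [shc_of_ne hz, inv_div]

theorem norm_integrand (n k₁ k₂ : ℕ) (R r : ℝ) (z : ℂ) :
    ‖integrand n k₁ k₂ R r z‖ =
      Real.exp (-(r * z.im) - R * (Complex.cosh z / shc z).re) * ‖Complex.cosh z / shc z‖ ^ k₁ *
        ‖z‖ ^ k₂ * ‖(shc z)⁻¹‖ ^ n := by
  rw [integrand, norm_mul, norm_mul, norm_mul, Complex.norm_exp, norm_pow, norm_pow, norm_pow,
    norm_neg, norm_mul, Complex.norm_I, one_mul]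
  congr 4
  simp

/-- For |x| ≥ 1 one has |sinh z| ≥ sinh |x| ≥ 3/4 and |coth z| ≤ 2. With R ≤ 1/8 the exponent is
therefore at most (5+|x|)/4, which the exponential decay of 1/sinh absorbs. -/
theorem exists_norm_integrand_le {n : ℕ} (hn : 0 < n) (k₁ k₂ : ℕ) :
    ∃ C : ℝ, ∀ R r x y : ℝ, 0 ≤ R → R ≤ 1 / 8 → 0 ≤ r → 1 ≤ |x| → 0 ≤ y →
      y ≤ 3 / 2 * Real.pi → ‖integrand n k₁ k₂ R r (x + y * Complex.I)‖ ≤ C * (1 + x ^ 2)⁻¹ := by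
  obtain ⟨C, hC, h⟩ := exists_pow_mul_exp_le (k₁ + k₂ + n)
  refine ⟨Real.exp (5 / 4) * 2 ^ k₁ * 4 ^ n * C, fun R r x y hR hR' hr hx hy hy' => ?_⟩
  have hz : (x + y * Complex.I : ℂ) ≠ 0 := by
    intro h0
    have := congrArg Complex.re h0
    simp at this
    norm_num [this] at hx
  have hzn := norm_add_mul_I_le (x := x) hy hy'
  have him : (x + y * Complex.I : ℂ).im = y := by simp
  have hsn := normSq_sinh x y
  have hcn := normSq_cosh x y
  rw [norm_integrand, cosh_div_shc hz, inv_shc hz, him]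
  set z : ℂ := x + y * Complex.I
  have hsh : Real.sinh x ^ 2 = Real.sinh |x| ^ 2 := by
    rcases abs_choice x with h | h <;> rw [h]
    simp
  have hexp : 2 ≤ Real.exp |x| := by linarith [Real.add_one_le_exp |x|]
  have hexp' : Real.exp |x| * Real.exp (-|x|) = 1 := by rw [← Real.exp_add]; simp
  have hexp'' : Real.exp (-|x|) ≤ 1 / 2 := by nlinarith [Real.exp_pos (-|x|)]
  have hs1 : Real.exp |x| / 4 ≤ Real.sinh |x| := by
    rw [Real.sinh_eq]; nlinarith
  have hs2 : 3 / 4 ≤ Real.sinh |x| := by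
    rw [Real.sinh_eq]; nlinarith
  have hs : Real.sinh |x| ≤ ‖Complex.sinh z‖ := by
    refine abs_le_of_sq_le_sq' ?_ (norm_nonneg _) |>.2
    rw [hsn, hsh]; nlinarith [sq_nonneg (Real.sin y)]
  have hspos : 0 < ‖Complex.sinh z‖ := by linarith
  have hinv : ‖z / Complex.sinh z‖ ≤ (5 + |x|) * (4 * Real.exp (-|x|)) := by
    rw [norm_div, div_le_iff₀ hspos]
    calc ‖z‖ ≤ (5 + |x|) * 1 := by rw [mul_one]; exact hzn
      _ ≤ (5 + |x|) * (4 * Real.exp (-|x|) * ‖Complex.sinh z‖) := by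
        gcongr
        nlinarith [Real.exp_pos (-|x|)]
      _ = _ := by ring
  have hcs : ‖Complex.cosh z‖ ≤ 2 * ‖Complex.sinh z‖ := by
    refine abs_le_of_sq_le_sq' ?_ (by positivity) |>.2
    rw [mul_pow, hcn, hsn, hsh]
    nlinarith [Real.sin_sq_add_cos_sq y]
  have hcoth : ‖z * (Complex.cosh z / Complex.sinh z)‖ ≤ 2 * (5 + |x|) := by
    rw [norm_mul, norm_div]
    have : ‖Complex.cosh z‖ / ‖Complex.sinh z‖ ≤ 2 := (div_le_iff₀ hspos).2 hcs
    nlinarith [norm_nonneg z, norm_nonneg (Complex.cosh z)]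
  have hre : -(r * y) - R * (z * (Complex.cosh z / Complex.sinh z)).re ≤ (5 + |x|) / 4 := by
    have h1 := (abs_le.1 ((Complex.abs_re_le_norm _).trans hcoth)).1
    have h2 : 0 ≤ r * y := by positivity
    nlinarith [abs_nonneg x]
  have hpow : (4 * Real.exp (-|x|)) ^ n ≤ 4 ^ n * Real.exp (-|x|) := by
    rw [mul_pow]
    gcongr
    simpa using pow_le_pow_of_le_one (Real.exp_pos _).le (by linarith : Real.exp (-|x|) ≤ 1) hn
  calc Real.exp (-(r * y) - R * (z * (Complex.cosh z / Complex.sinh z)).re) *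
          ‖z * (Complex.cosh z / Complex.sinh z)‖ ^ k₁ * ‖z‖ ^ k₂ * ‖z / Complex.sinh z‖ ^ n
      ≤ Real.exp ((5 + |x|) / 4) * (2 * (5 + |x|)) ^ k₁ * (5 + |x|) ^ k₂ *
          ((5 + |x|) * (4 * Real.exp (-|x|))) ^ n := by gcongr
    _ = 2 ^ k₁ * (5 + |x|) ^ (k₁ + k₂ + n) * Real.exp ((5 + |x|) / 4) *
          (4 * Real.exp (-|x|)) ^ n := by
        rw [mul_pow 2 (5 + |x|), mul_pow (5 + |x|) (4 * Real.exp (-|x|))]; ring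
    _ ≤ 2 ^ k₁ * (5 + |x|) ^ (k₁ + k₂ + n) * Real.exp ((5 + |x|) / 4) *
          (4 ^ n * Real.exp (-|x|)) := by gcongr
    _ = 2 ^ k₁ * (5 + |x|) ^ (k₁ + k₂ + n) * 4 ^ n * (Real.exp ((5 + |x|) / 4 + -|x|)) := by
        rw [Real.exp_add]; ring
    _ ≤ 2 ^ k₁ * (5 + |x|) ^ (k₁ + k₂ + n) * 4 ^ n * (Real.exp (5 / 4 + -|x| / 2)) := by
        refine mul_le_mul_of_nonneg_left (Real.exp_le_exp.2 ?_) (by positivity)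
        linarith
    _ = Real.exp (5 / 4) * 2 ^ k₁ * 4 ^ n * ((5 + |x|) ^ (k₁ + k₂ + n) * Real.exp (-|x| / 2)) := by
        rw [Real.exp_add]; ring
    _ ≤ Real.exp (5 / 4) * 2 ^ k₁ * 4 ^ n * (C * (1 + x ^ 2)⁻¹) :=
        mul_le_mul_of_nonneg_left (h x) (by positivity)
    _ = _ := by ring

/-- At height 3π/2 the cosine vanishes, so coth z = tanh x is real and Re(z coth z) = x tanh x ≥ 0.
The R-term then only helps, while exp(irz) supplies the factor e^{-3πr/2}. -/
theorem exists_norm_integrand_top_le {n : ℕ} (hn : 0 < n) (k₁ k₂ : ℕ) :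
    ∃ C : ℝ, ∀ R r x : ℝ, 0 ≤ R →
      ‖integrand n k₁ k₂ R r (x + (3 / 2 * Real.pi : ℝ) * Complex.I)‖ ≤
        Real.exp (-(r * (3 / 2 * Real.pi))) * (C * (1 + x ^ 2)⁻¹) := by
  obtain ⟨C, hC, h⟩ := exists_pow_mul_exp_le (k₁ + k₂ + n)
  refine ⟨2 ^ n * C, fun R r x hR => ?_⟩
  have hp := Real.pi_pos
  have hz : (x + (3 / 2 * Real.pi : ℝ) * Complex.I : ℂ) ≠ 0 := by
    intro h0
    have := congrArg Complex.im h0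
    simp at this
  have hcos : Real.cos (3 / 2 * Real.pi) = 0 := by
    rw [show 3 / 2 * Real.pi = Real.pi / 2 + Real.pi by ring, Real.cos_add_pi]; simp
  have hsin : Real.sin (3 / 2 * Real.pi) = -1 := by
    rw [show 3 / 2 * Real.pi = Real.pi / 2 + Real.pi by ring, Real.sin_add_pi]; simp
  have hS : Complex.sinh (x + (3 / 2 * Real.pi : ℝ) * Complex.I) = -Real.cosh x * Complex.I := by
    rw [Complex.sinh_add, Complex.sinh_mul_I, Complex.cosh_mul_I, ← Complex.ofReal_cos,
      ← Complex.ofReal_sin, hcos, hsin]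
    simp
  have hC' : Complex.cosh (x + (3 / 2 * Real.pi : ℝ) * Complex.I) = -Real.sinh x * Complex.I := by
    rw [Complex.cosh_add, Complex.sinh_mul_I, Complex.cosh_mul_I, ← Complex.ofReal_cos,
      ← Complex.ofReal_sin, hcos, hsin]
    simp
  have hzn := norm_add_mul_I_le (x := x) (y := 3 / 2 * Real.pi) (by positivity) le_rfl
  have him : (x + (3 / 2 * Real.pi : ℝ) * Complex.I : ℂ).im = 3 / 2 * Real.pi := by simp
  have hre' : (x + (3 / 2 * Real.pi : ℝ) * Complex.I : ℂ).re = x := by simp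
  rw [norm_integrand, cosh_div_shc hz, inv_shc hz, him, hS, hC']
  set z : ℂ := x + (3 / 2 * Real.pi : ℝ) * Complex.I
  have hch := Real.cosh_pos x
  have hratio : (-Real.sinh x * Complex.I : ℂ) / (-Real.cosh x * Complex.I) =
      ((Real.sinh x / Real.cosh x : ℝ) : ℂ) := by
    have : (Real.cosh x : ℂ) ≠ 0 := by exact_mod_cast hch.ne'
    push_cast at this ⊢
    field_simp
  have htanh : |Real.sinh x / Real.cosh x| ≤ 1 := by
    rw [abs_div, abs_of_pos hch, div_le_one hch]
    exact abs_le_of_sq_le_sq (by nlinarith [Real.cosh_sq x]) hch.le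
  have htre : 0 ≤ x * (Real.sinh x / Real.cosh x) := by
    rw [← mul_div_assoc]
    refine div_nonneg ?_ hch.le
    rcases le_total 0 x with h | h
    · exact mul_nonneg h (Real.sinh_nonneg_iff.2 h)
    · exact mul_nonneg_of_nonpos_of_nonpos h (Real.sinh_nonpos_iff.2 h)
  rw [hratio, Complex.re_mul_ofReal, hre', norm_mul, norm_div, norm_mul, norm_neg, Complex.norm_I,
    mul_one, Complex.norm_real, Complex.norm_real, Real.norm_eq_abs, Real.norm_eq_abs,
    abs_of_pos hch]
  have hcosh : (1 : ℝ) ≤ Real.cosh x * (2 * Real.exp (-|x|)) := by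
    rw [← Real.cosh_abs, Real.cosh_eq]
    have : Real.exp |x| * Real.exp (-|x|) = 1 := by rw [← Real.exp_add]; simp
    nlinarith [Real.exp_pos (-|x|)]
  have hinv : ‖z‖ / Real.cosh x ≤ (5 + |x|) * (2 * Real.exp (-|x|)) := by
    rw [div_le_iff₀ hch]
    nlinarith [abs_nonneg x]
  have hpow : (2 * Real.exp (-|x|)) ^ n ≤ 2 ^ n * Real.exp (-|x|) := by
    rw [mul_pow]
    gcongr
    simpa using pow_le_pow_of_le_one (Real.exp_pos _).le (by simp : Real.exp (-|x|) ≤ 1) hn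
  calc Real.exp (-(r * (3 / 2 * Real.pi)) - R * (x * (Real.sinh x / Real.cosh x))) *
          (‖z‖ * |Real.sinh x / Real.cosh x|) ^ k₁ * ‖z‖ ^ k₂ * (‖z‖ / Real.cosh x) ^ n
      ≤ Real.exp (-(r * (3 / 2 * Real.pi))) * ((5 + |x|) * 1) ^ k₁ * (5 + |x|) ^ k₂ *
          ((5 + |x|) * (2 * Real.exp (-|x|))) ^ n := by
        gcongr
        nlinarith
    _ = Real.exp (-(r * (3 / 2 * Real.pi))) * ((5 + |x|) ^ (k₁ + k₂ + n) *
          (2 * Real.exp (-|x|)) ^ n) := by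
        rw [mul_pow (5 + |x|) (2 * Real.exp (-|x|))]; ring
    _ ≤ Real.exp (-(r * (3 / 2 * Real.pi))) * ((5 + |x|) ^ (k₁ + k₂ + n) *
          (2 ^ n * Real.exp (-|x| / 2))) := by
        refine mul_le_mul_of_nonneg_left (mul_le_mul_of_nonneg_left (hpow.trans ?_) (by positivity))
          (by positivity)
        gcongr
        linarith [abs_nonneg x]
    _ = Real.exp (-(r * (3 / 2 * Real.pi))) * (2 ^ n * ((5 + |x|) ^ (k₁ + k₂ + n) *
          Real.exp (-|x| / 2))) := by ring
    _ ≤ Real.exp (-(r * (3 / 2 * Real.pi))) * (2 ^ n * (C * (1 + x ^ 2)⁻¹)) := by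
        refine mul_le_mul_of_nonneg_left (mul_le_mul_of_nonneg_left (h x) (by positivity))
          (by positivity)
    _ = _ := by ring

/-- The shifted line contributes the error. The half-side 1/r ≤ 1 keeps the square about πi between
heights 0 and 3π/2, since π > 3. -/
theorem exists_norm_integral_integrand_sub_squareIntegral_le {n : ℕ} (hn : 0 < n) (k₁ k₂ : ℕ) :
    ∃ C : ℝ, 0 ≤ C ∧ ∀ R r : ℝ, 0 ≤ R → R ≤ 1 / 8 → 1 ≤ r →
      ‖(∫ l : ℝ, integrand n k₁ k₂ R r l) - (r⁻¹ : ℝ) * squareIntegral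
        fun w => integrand n k₁ k₂ R r (Real.pi * Complex.I + (r⁻¹ : ℝ) * w)‖ ≤
      C * Real.exp (-(r * (3 / 2 * Real.pi))) := by
  obtain ⟨C₁, h₁⟩ := exists_norm_integrand_le hn k₁ k₂
  obtain ⟨C₂, h₂⟩ := exists_norm_integrand_top_le hn k₁ k₂
  have hp3 := Real.pi_gt_three
  refine ⟨|∫ x : ℝ, C₂ * (1 + x ^ 2)⁻¹|, abs_nonneg _, fun R r hR hR' hr => ?_⟩
  have hd : ∀ z : ℂ, 0 ≤ z.im → z.im ≤ 3 / 2 * Real.pi → z ≠ Real.pi * Complex.I →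
      DifferentiableAt ℂ (integrand n k₁ k₂ R r) z := fun z h0 h1 h2 =>
    differentiableAt_integrand _ _ _ _ _ (shc_ne_zero (by linarith) (by linarith) h2)
  have hri : r⁻¹ ≤ 1 := inv_le_one_of_one_le₀ hr
  have hcont : Continuous fun x : ℝ =>
      integrand n k₁ k₂ R r (x + (3 / 2 * Real.pi : ℝ) * Complex.I) := by
    refine continuous_iff_continuousAt.2 fun x => ?_
    refine ContinuousAt.comp (f := fun x : ℝ => (x + (3 / 2 * Real.pi : ℝ) * Complex.I : ℂ))
      (hd _ ?_ ?_ ?_).continuousAt (continuous_horizontal _).continuousAt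
    · simp; linarith
    · simp
    · intro h
      have := congrArg Complex.im h
      simp at this
      linarith
  have hb : ∀ x : ℝ, ‖integrand n k₁ k₂ R r (x + (3 / 2 * Real.pi : ℝ) * Complex.I)‖ ≤
        Real.exp (-(r * (3 / 2 * Real.pi))) * (C₂ * (1 + x ^ 2)⁻¹) := fun x => h₂ R r x hR
  have hbi := (integrable_inv_one_add_sq.const_mul C₂).const_mul
    (Real.exp (-(r * (3 / 2 * Real.pi))))
  have key := integral_line_sub_integral_line_eq_squareIntegral (f := integrand n k₁ k₂ R r)
    (b := 3 / 2 * Real.pi) (c := Real.pi) (h := r⁻¹) (C := C₁) (by positivity) (by linarith)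
    (by linarith) hd (fun x y hx hy hy' => h₁ R r x y hR hR' (by linarith) hx hy hy')
    (integrable_integrand_ofReal hn k₁ k₂ (by linarith) r)
    (hbi.mono' hcont.aestronglyMeasurable (Eventually.of_forall hb))
  rw [← key, sub_sub_cancel]
  refine (norm_integral_le_of_norm_le hbi (Eventually.of_forall hb)).trans ?_
  rw [integral_const_mul, mul_comm]
  gcongr
  exact le_abs_self _

/-! ### Integrals over the boundary of the unit square. -/

/-- An annulus containing the boundary of the square `[-1,1]²`. -/
def annulus : Set ℂ := {w | 1 ≤ ‖w‖ ∧ ‖w‖ ≤ 2}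

theorem ne_zero_of_mem_annulus {w : ℂ} (hw : w ∈ annulus) : w ≠ 0 := by
  rintro rfl
  have := hw.1
  norm_num at this

theorem mem_annulus_of_re {x s : ℝ} (hx : x ∈ Icc (-1 : ℝ) 1) (hs : |s| = 1) :
    (x + s * Complex.I : ℂ) ∈ annulus := by
  constructor
  · have := Complex.abs_im_le_norm (x + s * Complex.I)
    simpa [hs] using this
  · refine (norm_add_le _ _).trans ?_
    have : |x| ≤ 1 := abs_le.2 hx
    simp [hs]
    linarith

theorem mem_annulus_of_im {y s : ℝ} (hy : y ∈ Icc (-1 : ℝ) 1) (hs : |s| = 1) :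
    (s + y * Complex.I : ℂ) ∈ annulus := by
  constructor
  · have := Complex.abs_re_le_norm (s + y * Complex.I)
    simpa [hs] using this
  · refine (norm_add_le _ _).trans ?_
    have : |y| ≤ 1 := abs_le.2 hy
    simp [hs]
    linarith

/-- A continuous path over `[-1,1]` in the annulus, such as a side of the square `[-1,1]²`. -/
def IsSide (σ : ℝ → ℂ) : Prop := Continuous σ ∧ ∀ x ∈ Icc (-1 : ℝ) 1, σ x ∈ annulus

theorem isSide_bottom : IsSide fun x => x - Complex.I :=
  ⟨by fun_prop, fun x hx => by simpa [sub_eq_add_neg] using mem_annulus_of_re hx (s := -1) (by simp)⟩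

theorem isSide_top : IsSide fun x => x + Complex.I :=
  ⟨by fun_prop, fun x hx => by simpa using mem_annulus_of_re hx (s := 1) (by simp)⟩

theorem isSide_right : IsSide fun y => 1 + y * Complex.I :=
  ⟨by fun_prop, fun x hx => by simpa using mem_annulus_of_im hx (s := 1) (by simp)⟩

theorem isSide_left : IsSide fun y => -1 + y * Complex.I :=
  ⟨by fun_prop, fun x hx => by simpa using mem_annulus_of_im hx (s := -1) (by simp)⟩

theorem IsSide.continuousOn {σ : ℝ → ℂ} (hσ : IsSide σ) {f : ℂ → ℂ} (hf : ContinuousOn f annulus) :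
    ContinuousOn (fun x => f (σ x)) (Icc (-1) 1) :=
  hf.comp hσ.1.continuousOn hσ.2

theorem IsSide.intervalIntegrable {σ : ℝ → ℂ} (hσ : IsSide σ) {f : ℂ → ℂ}
    (hf : ContinuousOn f annulus) :
    IntervalIntegrable (fun x => f (σ x)) volume (-1) 1 :=
  (hσ.continuousOn hf).intervalIntegrable_of_Icc (by norm_num)

theorem squareIntegral_const_mul (c : ℂ) (f : ℂ → ℂ) :
    squareIntegral (fun w => c * f w) = c * squareIntegral f := by
  simp only [squareIntegral, intervalIntegral.integral_const_mul]
  ring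

theorem squareIntegral_congr {f g : ℂ → ℂ} (h : EqOn f g annulus) :
    squareIntegral f = squareIntegral g := by
  have key : ∀ σ : ℝ → ℂ, IsSide σ →
      (∫ x : ℝ in (-1)..1, f (σ x)) = ∫ x : ℝ in (-1)..1, g (σ x) := fun σ hσ =>
    intervalIntegral.integral_congr fun x hx =>
      h (hσ.2 x (by rwa [uIcc_of_le (by norm_num)] at hx))
  rw [squareIntegral, squareIntegral, key _ isSide_bottom, key _ isSide_top, key _ isSide_right,
    key _ isSide_left]

theorem squareIntegral_add {f g : ℂ → ℂ} (hf : ContinuousOn f annulus)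
    (hg : ContinuousOn g annulus) :
    squareIntegral (fun w => f w + g w) = squareIntegral f + squareIntegral g := by
  have key : ∀ σ : ℝ → ℂ, IsSide σ → (∫ x : ℝ in (-1)..1, (f (σ x) + g (σ x))) =
      (∫ x : ℝ in (-1)..1, f (σ x)) + ∫ x : ℝ in (-1)..1, g (σ x) := fun σ hσ =>
    intervalIntegral.integral_add (hσ.intervalIntegrable hf) (hσ.intervalIntegrable hg)
  rw [squareIntegral, squareIntegral, squareIntegral, key _ isSide_bottom, key _ isSide_top,
    key _ isSide_right, key _ isSide_left]
  ring

theorem squareIntegral_sub {f g : ℂ → ℂ} (hf : ContinuousOn f annulus)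
    (hg : ContinuousOn g annulus) :
    squareIntegral (fun w => f w - g w) = squareIntegral f - squareIntegral g := by
  have hg' : ContinuousOn (fun w => -1 * g w) annulus := continuousOn_const.mul hg
  have := squareIntegral_add hf hg'
  rw [squareIntegral_const_mul] at this
  simpa [sub_eq_add_neg] using this

theorem norm_squareIntegral_le {f : ℂ → ℂ} {ε : ℝ} (hf : ∀ w ∈ annulus, ‖f w‖ ≤ ε) :
    ‖squareIntegral f‖ ≤ 8 * ε := by
  have key : ∀ σ : ℝ → ℂ, IsSide σ → ‖∫ x : ℝ in (-1)..1, f (σ x)‖ ≤ 2 * ε := by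
    intro σ hσ
    have := intervalIntegral.norm_integral_le_of_norm_le_const (f := fun x => f (σ x))
      (a := -1) (b := 1) (C := ε) fun x hx => hf _ (hσ.2 x ?_)
    · norm_num at this
      linarith
    · rw [uIoc_of_le (by norm_num)] at hx
      exact ⟨hx.1.le, hx.2⟩
  have h1 := key _ isSide_bottom
  have h2 := key _ isSide_top
  have h3 := key _ isSide_right
  have h4 := key _ isSide_left
  rw [squareIntegral]
  refine (norm_sub_le _ _).trans ?_
  refine (add_le_add_left (norm_add_le _ _) _).trans ?_
  refine (add_le_add_left (add_le_add_left (norm_sub_le _ _) _) _).trans ?_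
  rw [norm_mul, norm_mul, Complex.norm_I]
  linarith

theorem hasSum_squareIntegral {F : ℕ → ℂ → ℂ} {f : ℂ → ℂ} {B : ℕ → ℝ}
    (hF : ∀ k, ContinuousOn (F k) annulus) (hB : ∀ k, ∀ w ∈ annulus, ‖F k w‖ ≤ B k)
    (hs : Summable B) (h : ∀ w ∈ annulus, HasSum (fun k => F k w) (f w)) :
    HasSum (fun k => squareIntegral (F k)) (squareIntegral f) := by
  have key : ∀ σ : ℝ → ℂ, IsSide σ → HasSum (fun k => ∫ x : ℝ in (-1)..1, F k (σ x))
      (∫ x : ℝ in (-1)..1, f (σ x)) := by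
    intro σ hσ
    have mem : ∀ x ∈ uIoc (-1 : ℝ) 1, σ x ∈ annulus := fun x hx => by
      rw [uIoc_of_le (by norm_num)] at hx
      exact hσ.2 x ⟨hx.1.le, hx.2⟩
    exact intervalIntegral.hasSum_integral_of_dominated_convergence (fun k _ => B k)
      (fun k => ((hσ.intervalIntegrable (hF k)).def').aestronglyMeasurable)
      (fun k => Eventually.of_forall fun x hx => hB k _ (mem x hx))
      (Eventually.of_forall fun x _ => hs) intervalIntegrable_const
      (Eventually.of_forall fun x hx => h _ (mem x hx))
  exact ((((key _ isSide_bottom).sub (key _ isSide_top)).add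
    ((key _ isSide_right).mul_left _)).sub ((key _ isSide_left).mul_left _))

/-- By the fundamental theorem of calculus each side gives a difference of corner values of the
primitive, and these cancel around the square. -/
theorem squareIntegral_eq_zero_of_hasDerivAt {g g' : ℂ → ℂ}
    (h : ∀ w ∈ annulus, HasDerivAt g (g' w) w) (hc : ContinuousOn g' annulus) :
    squareIntegral g' = 0 := by
  have key : ∀ (σ : ℝ → ℂ) (c : ℂ), IsSide σ → (∀ x, HasDerivAt σ c x) →
      c * (∫ x : ℝ in (-1)..1, g' (σ x)) = g (σ 1) - g (σ (-1)) := by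
    intro σ c hσ hd
    rw [← intervalIntegral.integral_const_mul]
    refine intervalIntegral.integral_eq_sub_of_hasDerivAt (f := fun x => g (σ x)) (fun x hx => ?_)
      ((hσ.intervalIntegrable hc).const_mul c)
    rw [uIcc_of_le (by norm_num)] at hx
    rw [mul_comm]
    exact (h _ (hσ.2 x hx)).comp x (hd x)
  have d1 : ∀ x : ℝ, HasDerivAt (fun x : ℝ => (x : ℂ)) 1 x := fun x => (hasDerivAt_id x).ofReal_comp
  have k1 := key _ 1 isSide_bottom fun x => (d1 x).sub_const _
  have k2 := key _ 1 isSide_top fun x => (d1 x).add_const _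
  have k3 := key _ Complex.I isSide_right fun x => by
    simpa using ((d1 x).mul_const Complex.I).const_add 1
  have k4 := key _ Complex.I isSide_left fun x => by
    simpa using ((d1 x).mul_const Complex.I).const_add (-1)
  rw [one_mul] at k1 k2
  rw [squareIntegral, k1, k2, k3, k4]
  push_cast
  ring_nf

theorem squareIntegral_eq_zero_of_differentiable {f : ℂ → ℂ} (hf : Differentiable ℂ f) :
    squareIntegral f = 0 := by
  have := Complex.integral_boundary_rect_eq_zero_of_differentiableOn f (-1 - Complex.I)
    (1 + Complex.I) hf.differentiableOn
  simpa [squareIntegral, sub_eq_add_neg] using this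

/-- Pairing opposite sides leaves multiples of 1/(1 + x²), whose integral over [-1,1] is π/2. -/
theorem squareIntegral_inv : squareIntegral (fun w => w⁻¹) = 2 * Real.pi * Complex.I := by
  have hc : ContinuousOn (fun w : ℂ => w⁻¹) annulus :=
    continuousOn_inv₀.mono fun w hw => ne_zero_of_mem_annulus hw
  have hint : (∫ x : ℝ in (-1)..1, (((1 + x ^ 2)⁻¹ : ℝ) : ℂ)) = Real.pi / 2 := by
    rw [intervalIntegral.integral_ofReal, integral_inv_one_add_sq]
    simp only [Real.arctan_one, Real.arctan_neg]
    push_cast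
    ring
  have hx : ∀ x : ℝ, (1 + x ^ 2 : ℂ) ≠ 0 := fun x => by
    have : (1 + x ^ 2 : ℝ) ≠ 0 := by positivity
    exact_mod_cast this
  have h1 : (∫ x : ℝ in (-1)..1, (x - Complex.I : ℂ)⁻¹) -
      (∫ x : ℝ in (-1)..1, (x + Complex.I : ℂ)⁻¹) = 2 * Complex.I * (Real.pi / 2) := by
    rw [← intervalIntegral.integral_sub (isSide_bottom.intervalIntegrable hc)
      (isSide_top.intervalIntegrable hc), ← hint, ← intervalIntegral.integral_const_mul]
    refine intervalIntegral.integral_congr fun x hx' => ?_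
    rw [uIcc_of_le (by norm_num)] at hx'
    have e1 := ne_zero_of_mem_annulus (isSide_bottom.2 x hx')
    have e2 := ne_zero_of_mem_annulus (isSide_top.2 x hx')
    have e3 := hx x
    have : (1 + x ^ 2 : ℂ) = (x - Complex.I) * (x + Complex.I) := by
      linear_combination Complex.I_sq
    push_cast
    rw [this]
    field_simp
    ring
  have h2 : (∫ y : ℝ in (-1)..1, (1 + y * Complex.I : ℂ)⁻¹) -
      (∫ y : ℝ in (-1)..1, (-1 + y * Complex.I : ℂ)⁻¹) = 2 * (Real.pi / 2) := by
    rw [← intervalIntegral.integral_sub (isSide_right.intervalIntegrable hc)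
      (isSide_left.intervalIntegrable hc), ← hint, ← intervalIntegral.integral_const_mul]
    refine intervalIntegral.integral_congr fun x hx' => ?_
    rw [uIcc_of_le (by norm_num)] at hx'
    have e1 := ne_zero_of_mem_annulus (isSide_right.2 x hx')
    have e2 := ne_zero_of_mem_annulus (isSide_left.2 x hx')
    have e3 := hx x
    have : (1 + x ^ 2 : ℂ) = -((1 + x * Complex.I) * (-1 + x * Complex.I)) := by
      linear_combination x ^ 2 * Complex.I_sq
    push_cast
    rw [this]
    field_simp
    ring
  rw [squareIntegral]
  linear_combination h1 + Complex.I * h2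

theorem continuousOn_inv_pow_mul_exp (q : ℕ) :
    ContinuousOn (fun w : ℂ => (w ^ q)⁻¹ * Complex.exp (Complex.I * w)) annulus := by
  refine ContinuousOn.mul (ContinuousOn.inv₀ (by fun_prop) fun w hw => ?_) (by fun_prop)
  exact pow_ne_zero _ (ne_zero_of_mem_annulus hw)

theorem squareIntegral_inv_pow_mul_exp (q : ℕ) :
    squareIntegral (fun w => (w ^ (q + 1))⁻¹ * Complex.exp (Complex.I * w)) =
      2 * Real.pi * Complex.I * Complex.I ^ q / q.factorial := by
  induction q with
  | zero =>
    -- E is the entire function (e^{iw} - 1)/w, so only 1/w contributes.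
    set E : ℂ → ℂ := dslope (fun w => Complex.exp (Complex.I * w)) 0 with hE
    have hEd : Differentiable ℂ E := by
      refine differentiableOn_univ.1 ((Complex.differentiableOn_dslope univ_mem).2 ?_)
      fun_prop
    have h1 : squareIntegral (fun w => (w ^ (0 + 1))⁻¹ * Complex.exp (Complex.I * w)) =
        squareIntegral fun w => E w + w⁻¹ := by
      refine squareIntegral_congr fun w hw => ?_
      have hw0 := ne_zero_of_mem_annulus hw
      simp only [hE, dslope_of_ne _ hw0, slope_def_field]
      simp only [mul_zero, Complex.exp_zero]
      field_simp
      ring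
    rw [h1, squareIntegral_add hEd.continuous.continuousOn
      (continuousOn_inv₀.mono fun w hw => ne_zero_of_mem_annulus hw),
      squareIntegral_eq_zero_of_differentiable hEd, squareIntegral_inv]
    simp
  | succ q ih =>
    have hq : ((q : ℂ) + 1) ≠ 0 := by exact_mod_cast q.succ_ne_zero
    have hc : ∀ (c : ℂ) (q : ℕ), ContinuousOn
        (fun w : ℂ => c * ((w ^ q)⁻¹ * Complex.exp (Complex.I * w))) annulus :=
      fun c q => continuousOn_const.mul (continuousOn_inv_pow_mul_exp q)
    -- The derivative of w^{-(q+1)} e^{iw} integrates to zero, which relates the pole of order q + 2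
    -- to the one of order q + 1.
    have h1 := squareIntegral_eq_zero_of_hasDerivAt
      (g := fun w => (w ^ (q + 1))⁻¹ * Complex.exp (Complex.I * w))
      (g' := fun w => Complex.I * ((w ^ (q + 1))⁻¹ * Complex.exp (Complex.I * w)) -
        (q + 1) * ((w ^ (q + 1 + 1))⁻¹ * Complex.exp (Complex.I * w))) ?_ ?_
    · rw [squareIntegral_sub (hc _ _) (hc _ _), squareIntegral_const_mul,
        squareIntegral_const_mul, ih] at h1
      have hf : ((q.factorial : ℕ) : ℂ) ≠ 0 := by exact_mod_cast q.factorial_ne_zero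
      rw [Nat.factorial_succ]
      push_cast
      rw [eq_div_iff (mul_ne_zero hq hf)]
      have h2 : Complex.I * (2 * Real.pi * Complex.I * Complex.I ^ q / q.factorial) =
        Complex.I * (2 * Real.pi * Complex.I * Complex.I ^ q) / q.factorial := by ring
      rw [h2, sub_eq_zero, div_eq_iff hf] at h1
      rw [pow_succ]
      linear_combination -h1
    · intro w hw
      have hw0 := ne_zero_of_mem_annulus hw
      have d1 := ((hasDerivAt_pow (q + 1) w).inv (pow_ne_zero _ hw0)).mul
        (((hasDerivAt_id w).const_mul Complex.I).cexp)
      refine d1.congr_deriv ?_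
      simp only [id, Nat.add_sub_cancel, Pi.inv_apply]
      push_cast
      field_simp
      ring
    · exact (hc _ _).sub (hc _ _)

/-! ### The Bessel series as a contour integral. -/

/-- The entire function `∑ aᵏ / (k! (k + m)!)`. -/
def besselSeries (m : ℕ) (a : ℝ) : ℝ := ∑' k : ℕ, a ^ k / (k.factorial * (k + m).factorial)

theorem summable_besselSeries (m : ℕ) (a : ℝ) :
    Summable fun k : ℕ => a ^ k / (k.factorial * (k + m).factorial : ℝ) := by
  refine Summable.of_norm_bounded (Real.summable_pow_div_factorial |a|) fun k => ?_
  have h : (1 : ℝ) ≤ (k + m).factorial := by exact_mod_cast (k + m).factorial_pos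
  rw [norm_div, norm_pow, Real.norm_eq_abs, Real.norm_of_nonneg (by positivity)]
  gcongr
  have : (0 : ℝ) < k.factorial := by exact_mod_cast k.factorial_pos
  nlinarith

/-- Expand exp(a/(iw)) and integrate termwise: the k-th term has a pole of order k + m + 1, whose
residue brings 1/(k+m)!. Since |w| ≥ 1 and |e^{iw}| ≤ e² on the annulus, the exponential series of
|a| dominates. -/
theorem squareIntegral_exp_add_inv (m : ℕ) (a : ℝ) :
    squareIntegral (fun w => ((Complex.I * w) ^ (m + 1))⁻¹ *
      Complex.exp (Complex.I * w + a / (Complex.I * w))) = 2 * Real.pi * besselSeries m a := by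
  set F : ℕ → ℂ → ℂ := fun k w => (a ^ k / (k.factorial * Complex.I ^ (k + m + 1))) *
    ((w ^ (k + m + 1))⁻¹ * Complex.exp (Complex.I * w)) with hF
  have hI := Complex.I_ne_zero
  have key := hasSum_squareIntegral (F := F)
    (f := fun w => ((Complex.I * w) ^ (m + 1))⁻¹ *
      Complex.exp (Complex.I * w + a / (Complex.I * w)))
    (B := fun k => Real.exp 2 * (|a| ^ k / k.factorial))
    (fun k => continuousOn_const.mul (continuousOn_inv_pow_mul_exp _)) ?_
    ((Real.summable_pow_div_factorial |a|).mul_left _) ?_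
  · refine key.unique ?_
    have hs := ((summable_besselSeries m a).hasSum.mapL Complex.ofRealCLM).mul_left
      (2 * Real.pi : ℂ)
    refine Eq.subst (motive := fun g => HasSum g _) (funext fun k => ?_) hs
    have h1 := Nat.cast_ne_zero (R := ℂ).2 k.factorial_ne_zero
    have h2 := Nat.cast_ne_zero (R := ℂ).2 (k + m).factorial_ne_zero
    simp only [hF, squareIntegral_const_mul, squareIntegral_inv_pow_mul_exp,
      Complex.ofRealCLM_apply]
    push_cast
    field_simp
    ring
  · intro k w hw
    simp only [hF, norm_mul, norm_div, norm_pow, norm_inv, Complex.norm_I, one_pow,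
      Complex.norm_real, Real.norm_eq_abs, mul_one, Complex.norm_natCast]
    have e1 : (‖w‖ ^ (k + m + 1))⁻¹ ≤ 1 := inv_le_one_of_one_le₀ (one_le_pow₀ hw.1)
    have e2 : ‖Complex.exp (Complex.I * w)‖ ≤ Real.exp 2 := by
      rw [Complex.norm_exp]
      refine Real.exp_le_exp.2 ((Complex.re_le_norm _).trans ?_)
      rw [norm_mul, Complex.norm_I, one_mul]
      exact hw.2
    calc |a| ^ k / k.factorial * ((‖w‖ ^ (k + m + 1))⁻¹ * ‖Complex.exp (Complex.I * w)‖)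
        ≤ |a| ^ k / k.factorial * (1 * Real.exp 2) := by gcongr
      _ = _ := by ring
  · intro w hw
    have hw0 := ne_zero_of_mem_annulus hw
    have h1 : HasSum (fun k : ℕ => (a / (Complex.I * w)) ^ k / (k.factorial : ℂ))
        (Complex.exp (a / (Complex.I * w))) := by
      rw [Complex.exp_eq_exp_ℂ]
      exact NormedSpace.expSeries_div_hasSum_exp _
    rw [Complex.exp_add, ← mul_assoc]
    refine Eq.subst (motive := fun g => HasSum g _) (funext fun k => ?_)
      (h1.mul_left (((Complex.I * w) ^ (m + 1))⁻¹ * Complex.exp (Complex.I * w)))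
    have := Nat.cast_ne_zero (R := ℂ).2 k.factorial_ne_zero
    simp only [hF, div_pow, mul_pow]
    field_simp
    ring

/-! ### The integrand near πi. -/

theorem exists_norm_sub_le_mul_norm {P : ℂ → ℂ} (hP : DifferentiableAt ℂ P 0) :
    ∃ K : ℝ, 0 ≤ K ∧ ∃ ρ : ℝ, 0 < ρ ∧ ∀ v : ℂ, ‖v‖ ≤ ρ → ‖P v - P 0‖ ≤ K * ‖v‖ := by
  obtain ⟨K, hK, h⟩ := hP.isBigO_sub.exists_nonneg
  obtain ⟨ρ, hρ, h'⟩ := Metric.eventually_nhds_iff.1 h.bound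
  refine ⟨K, hK, ρ / 2, by positivity, fun v hv => ?_⟩
  simpa using h' (y := v) (by rw [dist_zero_right]; linarith)

/-- Freezing the amplitude P and the phase Q at 0 costs O(h), since |hw| ≤ 2h on the annulus,
uniformly for b in [0, A]. -/
theorem exists_norm_exp_mul_sub_le {P Q : ℂ → ℂ} (hP : DifferentiableAt ℂ P 0)
    (hQ : DifferentiableAt ℂ Q 0) (M : ℕ) (A : ℝ) :
    ∃ C : ℝ, 0 ≤ C ∧ ∃ ρ : ℝ, 0 < ρ ∧ ∀ b h : ℝ, 0 ≤ b → b ≤ A → 0 < h → h ≤ ρ → ∀ w ∈ annulus,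
      ‖(w ^ M)⁻¹ * Complex.exp (Complex.I * w + b * Q (h * w) / w) * P (h * w) -
        (w ^ M)⁻¹ * Complex.exp (Complex.I * w + b * Q 0 / w) * P 0‖ ≤ C * h := by
  obtain ⟨K₁, hK₁, ρ₁, hρ₁, h₁⟩ := exists_norm_sub_le_mul_norm hP
  obtain ⟨K₂, hK₂, ρ₂, hρ₂, h₂⟩ := exists_norm_sub_le_mul_norm hQ
  -- The first two bounds on h keep hw where P and Q are Lipschitz at 0; the third makes the change
  -- d of the exponent at most 1, so that |e^d - 1| ≤ 2|d|.
  refine ⟨Real.exp (2 + |A| * ‖Q 0‖) * (4 * |A| * K₂ * (‖P 0‖ + K₁ * ρ₁) + 2 * K₁), by positivity,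
    min (ρ₁ / 2) (min (ρ₂ / 2) (1 / (2 * |A| * K₂ + 1))), by positivity,
    fun b h hb hbA hh hhρ w hw => ?_⟩
  have hA : b ≤ |A| := hbA.trans (le_abs_self A)
  have hw0 := ne_zero_of_mem_annulus hw
  have hw1 : ‖w‖⁻¹ ≤ 1 := inv_le_one_of_one_le₀ hw.1
  have hv : ‖(h * w : ℂ)‖ ≤ 2 * h := by
    rw [norm_mul, Complex.norm_real, Real.norm_of_nonneg hh.le]
    nlinarith [hw.2]
  obtain ⟨i1, i2⟩ := le_min_iff.1 hhρ
  obtain ⟨i2, i3⟩ := le_min_iff.1 i2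
  have hP' := h₁ (h * w) (by linarith)
  have hQ' := h₂ (h * w) (by linarith)
  set v : ℂ := h * w
  rw [le_div_iff₀ (by positivity)] at i3
  set d : ℂ := b * (Q v - Q 0) / w with hd
  have hdn : ‖d‖ ≤ 2 * |A| * K₂ * h := by
    rw [hd, norm_div, norm_mul, Complex.norm_real, Real.norm_of_nonneg hb, div_eq_mul_inv]
    calc b * ‖Q v - Q 0‖ * ‖w‖⁻¹ ≤ |A| * (K₂ * (2 * h)) * 1 := by
          gcongr
          exact hQ'.trans (by gcongr)
      _ = _ := by ring
  have hd1 : ‖d‖ ≤ 1 := by nlinarith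
  have hexp : ‖Complex.exp d - 1‖ ≤ 4 * |A| * K₂ * h := by
    refine (Complex.norm_exp_sub_one_le hd1).trans ?_
    linarith
  have hE : ‖Complex.exp (Complex.I * w + b * Q 0 / w)‖ ≤ Real.exp (2 + |A| * ‖Q 0‖) := by
    rw [Complex.norm_exp]
    refine Real.exp_le_exp.2 ((Complex.re_le_norm _).trans ((norm_add_le _ _).trans ?_))
    rw [norm_mul, Complex.norm_I, norm_div, norm_mul, Complex.norm_real, Real.norm_of_nonneg hb,
      div_eq_mul_inv]
    have : b * ‖Q 0‖ * ‖w‖⁻¹ ≤ |A| * ‖Q 0‖ * 1 := by gcongr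
    linarith [hw.2]
  have hPv : ‖P v‖ ≤ ‖P 0‖ + K₁ * ρ₁ := by
    have := norm_le_norm_add_norm_sub (P 0) (P v)
    have h3 : K₁ * ‖v‖ ≤ K₁ * ρ₁ := by gcongr; linarith
    rw [norm_sub_rev] at this
    linarith
  have hPd : ‖P v - P 0‖ ≤ 2 * K₁ * h := by
    have h3 : K₁ * ‖v‖ ≤ K₁ * (2 * h) := by gcongr
    linarith
  have hsplit : Complex.exp (Complex.I * w + b * Q v / w) =
      Complex.exp (Complex.I * w + b * Q 0 / w) * Complex.exp d := by
    rw [← Complex.exp_add]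
    congr 1
    rw [hd]
    ring
  have hM : ‖((w ^ M)⁻¹ : ℂ)‖ ≤ 1 := by
    rw [norm_inv, norm_pow]
    exact inv_le_one_of_one_le₀ (one_le_pow₀ hw.1)
  rw [hsplit]
  have : (w ^ M)⁻¹ * (Complex.exp (Complex.I * w + b * Q 0 / w) * Complex.exp d) * P v -
        (w ^ M)⁻¹ * Complex.exp (Complex.I * w + b * Q 0 / w) * P 0 =
      (w ^ M)⁻¹ * Complex.exp (Complex.I * w + b * Q 0 / w) *
        ((Complex.exp d - 1) * P v + (P v - P 0)) := by ring
  rw [this, norm_mul, norm_mul]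
  calc ‖((w ^ M)⁻¹ : ℂ)‖ * ‖Complex.exp (Complex.I * w + b * Q 0 / w)‖ *
        ‖(Complex.exp d - 1) * P v + (P v - P 0)‖
      ≤ 1 * Real.exp (2 + |A| * ‖Q 0‖) *
        ((4 * |A| * K₂ * h) * (‖P 0‖ + K₁ * ρ₁) + 2 * K₁ * h) := by
        gcongr
        refine (norm_add_le _ _).trans ?_
        rw [norm_mul]
        gcongr
    _ = _ := by ring

/-- The phase of the integrand near its singularity `π i`, without the pole. -/
def localPhase (v : ℂ) : ℂ := -((Real.pi * Complex.I + v) * Complex.cosh v / shc v)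

/-- The amplitude of the integrand near its singularity `π i`, without the pole. -/
def localAmplitude (n k₁ k₂ : ℕ) (v : ℂ) : ℂ :=
  localPhase v ^ k₁ * (Complex.I * (Real.pi * Complex.I + v)) ^ k₂ *
    (-((Real.pi * Complex.I + v) / shc v)) ^ n

theorem differentiableAt_localPhase : DifferentiableAt ℂ localPhase 0 := by
  have h : shc 0 ≠ 0 := by simp [shc_zero]
  have h1 := differentiable_shc 0
  unfold localPhase
  exact DifferentiableAt.fun_neg (DifferentiableAt.fun_div (by fun_prop) h1 h)

theorem differentiableAt_localAmplitude (n k₁ k₂ : ℕ) :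
    DifferentiableAt ℂ (localAmplitude n k₁ k₂) 0 := by
  have h : shc 0 ≠ 0 := by simp [shc_zero]
  have h1 := differentiable_shc 0
  have h2 := differentiableAt_localPhase
  have h3 : DifferentiableAt ℂ (fun v => -((Real.pi * Complex.I + v) / shc v)) 0 :=
    DifferentiableAt.fun_neg (DifferentiableAt.fun_div (by fun_prop) h1 h)
  unfold localAmplitude
  fun_prop

theorem localPhase_zero : localPhase 0 = -(Real.pi * Complex.I) := by
  simp [localPhase, shc_zero]

/-- The power of i is isolated as i^{-(n+k₁)} so that it merges with w^{-(n+k₁)} into a power of iw.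
-/
theorem localAmplitude_zero (n k₁ k₂ : ℕ) :
    localAmplitude n k₁ k₂ 0 =
      (-1) ^ k₂ * Real.pi ^ (n + k₁ + k₂) * (Complex.I ^ (n + k₁))⁻¹ := by
  have h1 : -(Real.pi * Complex.I) = Real.pi * Complex.I⁻¹ := by simp
  have h2 : Complex.I * (Real.pi * Complex.I) = -1 * Real.pi := by
    linear_combination (Real.pi : ℂ) * Complex.I_sq
  rw [localAmplitude, localPhase_zero, shc_zero, add_zero, div_one, h1, h2]
  simp only [mul_pow, inv_pow, pow_add, mul_inv]
  ring

/-- Translation by πi changes the sign of both cosh and sinh, so each of the n factors 1/shc and of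
the k₁ factors z coth z has a simple pole in v = w/r. This accounts for the order m + 1 = n + k₁ and
the power r^{m+1}. -/
theorem integrand_near_pole {n k₁ k₂ m : ℕ} (hm : n + k₁ = m + 1) {R r : ℝ} (hr : 0 < r) {w : ℂ}
    (hw : w ≠ 0) (hv : ‖((r⁻¹ : ℝ) * w : ℂ)‖ < Real.pi) :
    integrand n k₁ k₂ R r (Real.pi * Complex.I + (r⁻¹ : ℝ) * w) =
      (Real.exp (-(Real.pi * r)) * r ^ (m + 1) : ℝ) *
        ((w ^ (m + 1))⁻¹ * Complex.exp (Complex.I * w +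
          (R * r : ℝ) * localPhase ((r⁻¹ : ℝ) * w) / w) *
          localAmplitude n k₁ k₂ ((r⁻¹ : ℝ) * w)) := by
  have hr0 : (r : ℂ) ≠ 0 := by exact_mod_cast hr.ne'
  have hw' : w = r * ((r⁻¹ : ℝ) * w) := by push_cast; field_simp
  set v : ℂ := (r⁻¹ : ℝ) * w
  have hv0 : v ≠ 0 := by
    intro h
    rw [h, mul_zero] at hw'
    exact hw hw'
  have hvi := (Complex.abs_im_le_norm v).trans_lt hv
  rw [abs_lt] at hvi
  have hs : shc v ≠ 0 := shc_ne_zero (by linarith) (by linarith [Real.pi_pos]) fun h => by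
    rw [h] at hvi
    simp at hvi
  have hz : (Real.pi * Complex.I + v : ℂ) ≠ 0 := fun h => by
    have := congrArg Complex.im h
    simp at this
    linarith
  have hC : Complex.cosh (Real.pi * Complex.I + v) = -Complex.cosh v := by
    rw [Complex.cosh_add, Complex.cosh_mul_I, Complex.sinh_mul_I]; simp
  have hS : Complex.sinh (Real.pi * Complex.I + v) = -(v * shc v) := by
    rw [mul_shc, Complex.sinh_add, Complex.cosh_mul_I, Complex.sinh_mul_I]; simp
  have e1 : Complex.cosh (Real.pi * Complex.I + v) / shc (Real.pi * Complex.I + v) =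
      -(localPhase v / v) := by
    rw [cosh_div_shc hz, hC, hS, localPhase]
    field_simp
  have e2 : (shc (Real.pi * Complex.I + v))⁻¹ = -((Real.pi * Complex.I + v) / shc v) / v := by
    rw [inv_shc hz, hS]
    field_simp
  rw [integrand, e1, e2, localAmplitude, neg_neg, div_pow, div_pow, ← hm, hw']
  have e3 : Complex.I * r * (Real.pi * Complex.I + v) - R * -(localPhase v / v) =
      ((-(Real.pi * r) : ℝ) : ℂ) +
        (Complex.I * (r * v) + (R * r : ℝ) * localPhase v / (r * v)) := by
    push_cast
    field_simp
    linear_combination (r * Real.pi * v : ℂ) * Complex.I_sq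
  rw [e3, Complex.exp_add]
  push_cast
  field_simp
  ring

theorem exists_norm_integral_integrand_sub_le {n : ℕ} (hn : 0 < n) (k₁ k₂ : ℕ) {m : ℕ}
    (hm : n + k₁ = m + 1) (A : ℝ) :
    ∃ T : ℝ, 1 ≤ T ∧ ∃ K : ℝ, 0 ≤ K ∧ ∀ R r : ℝ, 0 ≤ R → T ≤ r → Real.pi * r * R ≤ A →
      ‖(∫ l : ℝ, integrand n k₁ k₂ R r l) -
        (2 * Real.pi * ((-1) ^ k₂ * Real.pi ^ (n + k₁ + k₂)) * (r ^ m * Real.exp (-(Real.pi * r))) *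
          besselSeries m (Real.pi * r * R) : ℝ)‖ ≤
      K * (r ^ m * Real.exp (-(Real.pi * r))) / r := by
  obtain ⟨C₁, hC₁, h₁⟩ := exists_norm_integral_integrand_sub_squareIntegral_le hn k₁ k₂
  obtain ⟨C₂, hC₂, ρ, hρ, h₂⟩ := exists_norm_exp_mul_sub_le
    (differentiableAt_localAmplitude n k₁ k₂) differentiableAt_localPhase (m + 1) A
  have hp := Real.pi_gt_three
  -- r ≥ 8A together with Rr ≤ A gives R ≤ 1/8, as the contour shift requires; r ≥ 1/ρ makes h = 1/r
  -- admissible in the local estimate.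
  refine ⟨max 1 (max (8 * A) ρ⁻¹), le_max_left _ _, C₁ + 8 * C₂, by positivity,
    fun R r hR hr hA => ?_⟩
  have hr1 : 1 ≤ r := (le_max_left _ _).trans hr
  have hr2 : 8 * A ≤ r := (le_max_left _ _).trans ((le_max_right _ _).trans hr)
  have hr3 : ρ⁻¹ ≤ r := (le_max_right _ _).trans ((le_max_right _ _).trans hr)
  have hr0 : 0 < r := by linarith
  have hrR : R * r ≤ A := by nlinarith [mul_nonneg hR hr0.le]
  have hri : r⁻¹ ≤ 1 := inv_le_one_of_one_le₀ hr1
  have b₁ := h₁ R r hR (by nlinarith) hr1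
  set L : ℂ → ℂ := fun w => (w ^ (m + 1))⁻¹ *
    Complex.exp (Complex.I * w + (R * r : ℝ) * localPhase 0 / w) * localAmplitude n k₁ k₂ 0 with hL
  set f : ℂ → ℂ := fun w => integrand n k₁ k₂ R r (Real.pi * Complex.I + (r⁻¹ : ℝ) * w) with hf
  set c : ℝ := Real.exp (-(Real.pi * r)) * r ^ (m + 1) with hc
  have hv : ∀ w ∈ annulus, ‖((r⁻¹ : ℝ) * w : ℂ)‖ < Real.pi := fun w hw => by
    rw [norm_mul, Complex.norm_real, Real.norm_of_nonneg (by positivity)]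
    nlinarith [hw.2, norm_nonneg w, inv_pos.2 hr0]
  have hfc : ContinuousOn f annulus := fun w hw => by
    have hw0 := ne_zero_of_mem_annulus hw
    have hvi := (Complex.abs_im_le_norm _).trans_lt (hv w hw)
    rw [abs_lt] at hvi
    refine ContinuousAt.continuousWithinAt (ContinuousAt.comp
      (f := fun w : ℂ => Real.pi * Complex.I + (r⁻¹ : ℝ) * w)
      (differentiableAt_integrand n k₁ k₂ R r (shc_ne_zero ?_ ?_ ?_)).continuousAt
      (by fun_prop))
    · have : (Real.pi * Complex.I + (r⁻¹ : ℝ) * w : ℂ).im =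
        Real.pi + ((r⁻¹ : ℝ) * w : ℂ).im := by simp
      rw [this]; linarith
    · have : (Real.pi * Complex.I + (r⁻¹ : ℝ) * w : ℂ).im =
        Real.pi + ((r⁻¹ : ℝ) * w : ℂ).im := by simp
      rw [this]; linarith
    · simpa [hr0.ne'] using hw0
  have hLc : ContinuousOn L annulus := fun w hw => by
    have hw0 := ne_zero_of_mem_annulus hw
    have h3 : ContinuousAt (fun w : ℂ => (w ^ (m + 1))⁻¹) w :=
      ContinuousAt.inv₀ (by fun_prop) (pow_ne_zero _ hw0)
    have h4 : ContinuousAt (fun w : ℂ => (R * r : ℝ) * localPhase 0 / w) w :=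
      ContinuousAt.div (by fun_prop) continuousAt_id hw0
    refine ContinuousAt.continuousWithinAt ?_
    fun_prop
  have hsq : ‖squareIntegral f - c * squareIntegral L‖ ≤ 8 * (c * (C₂ * r⁻¹)) := by
    have hcL : ContinuousOn (fun w => (c : ℂ) * L w) annulus := continuousOn_const.mul hLc
    rw [← squareIntegral_const_mul, ← squareIntegral_sub hfc hcL]
    refine norm_squareIntegral_le fun w hw => ?_
    simp only [hf, hL]
    rw [integrand_near_pole hm hr0 (ne_zero_of_mem_annulus hw) (hv w hw), ← hc, ← mul_sub,
      norm_mul, Complex.norm_real, Real.norm_of_nonneg (by positivity)]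
    gcongr
    exact h₂ (R * r) r⁻¹ (by positivity) hrR (by positivity) (inv_le_of_inv_le₀ hρ hr3) w hw
  have hLv : squareIntegral L = (((-1) ^ k₂ * Real.pi ^ (n + k₁ + k₂) : ℝ) : ℂ) *
      (2 * Real.pi * besselSeries m (Real.pi * r * R)) := by
    rw [← squareIntegral_exp_add_inv, ← squareIntegral_const_mul]
    refine squareIntegral_congr fun w hw => ?_
    have hw0 := ne_zero_of_mem_annulus hw
    simp only [hL]
    rw [localPhase_zero, localAmplitude_zero, mul_pow, mul_inv, hm]
    have : ((R * r : ℝ) : ℂ) * -(Real.pi * Complex.I) / w =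
        ((Real.pi * r * R : ℝ) : ℂ) / (Complex.I * w) := by
      have := Complex.I_ne_zero
      push_cast
      field_simp
      linear_combination -(R * r : ℂ) * Complex.I_sq
    rw [this]
    push_cast
    ring
  have hmain : (2 * Real.pi * ((-1) ^ k₂ * Real.pi ^ (n + k₁ + k₂)) *
      (r ^ m * Real.exp (-(Real.pi * r))) * besselSeries m (Real.pi * r * R) : ℝ) =
      ((r⁻¹ : ℝ) : ℂ) * (c * squareIntegral L) := by
    have : (r : ℂ) ≠ 0 := by exact_mod_cast hr0.ne'
    rw [hLv, hc]
    push_cast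
    field_simp
    ring
  -- The contour-shift error is absorbed: the spare factor e^{-πr/2} is at most 1/r.
  have hexp : Real.exp (-(r * (3 / 2 * Real.pi))) ≤ r ^ m * Real.exp (-(Real.pi * r)) / r := by
    have e1 : Real.exp (-(r * (3 / 2 * Real.pi))) =
        Real.exp (-(Real.pi * r)) * Real.exp (-(r * (Real.pi / 2))) := by
      rw [← Real.exp_add]; ring_nf
    have e2 : Real.exp (-(r * (Real.pi / 2))) ≤ r⁻¹ := by
      rw [Real.exp_neg]
      refine inv_anti₀ hr0 ?_
      have := Real.add_one_le_exp (r * (Real.pi / 2))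
      nlinarith
    rw [e1, div_eq_mul_inv]
    refine mul_le_mul ?_ e2 (Real.exp_pos _).le (by positivity)
    exact le_mul_of_one_le_left (Real.exp_pos _).le (one_le_pow₀ hr1)
  rw [hmain]
  calc _ ≤ ‖(∫ l : ℝ, integrand n k₁ k₂ R r l) - (r⁻¹ : ℝ) * squareIntegral f‖ +
        ‖((r⁻¹ : ℝ) : ℂ) * (squareIntegral f - c * squareIntegral L)‖ := by
        rw [mul_sub]
        exact norm_sub_le_norm_sub_add_norm_sub _ _ _
    _ ≤ C₁ * (r ^ m * Real.exp (-(Real.pi * r)) / r) + r⁻¹ * (8 * (c * (C₂ * r⁻¹))) := by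
        rw [norm_mul, Complex.norm_real, Real.norm_of_nonneg (by positivity : 0 ≤ r⁻¹)]
        gcongr
        exact b₁.trans (by gcongr)
    _ = _ := by
        rw [hc]
        field_simp
        ring

/-! ### The Carnot-Carathéodory distance near the centre. -/

theorem mul_cos_le_sin {y : ℝ} (h0 : 0 ≤ y) (h1 : y ≤ Real.pi / 2) : y * Real.cos y ≤ Real.sin y := by
  rcases h1.lt_or_eq with h1 | rfl
  · have hc : 0 < Real.cos y := Real.cos_pos_of_mem_Ioo ⟨by linarith, h1⟩
    have := Real.le_tan h0 h1
    rwa [Real.tan_eq_sin_div_cos, le_div_iff₀ hc] at this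
  · simp

theorem theta_of_ne {y : ℝ} (hy : y ≠ 0) :
    theta y = (y - Real.sin y * Real.cos y) / Real.sin y ^ 2 := by
  rw [theta, if_neg hy, Real.sin_two_mul, mul_assoc, ← mul_sub, mul_div_mul_left _ _ two_ne_zero]

/-- Used contrapositively: θ(y) ≥ 2 forces y > π/2, so that e = π - y lies in (0, π/2). -/
theorem theta_lt_two {y : ℝ} (h1 : y ≤ Real.pi / 2) : theta y < 2 := by
  rcases lt_trichotomy y 0 with h0 | rfl | h0
  · rw [theta, if_neg h0.ne]
    have h2 := Real.sin_lt (x := -(2 * y)) (by linarith)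
    rw [Real.sin_neg] at h2
    have : (2 * y - Real.sin (2 * y)) / (2 * Real.sin y ^ 2) ≤ 0 :=
      div_nonpos_of_nonpos_of_nonneg (by linarith) (by positivity)
    linarith
  · simp [theta]
  · rw [theta_of_ne h0.ne']
    have hs : 0 < Real.sin y := Real.sin_pos_of_pos_of_lt_pi h0 (by linarith [Real.pi_pos])
    have hc : 0 ≤ Real.cos y := Real.cos_nonneg_of_mem_Icc ⟨by linarith, h1⟩
    rw [div_lt_iff₀ (by positivity)]
    have h2 := mul_cos_le_sin h0.le h1
    have h3 := Real.pi_lt_d2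
    nlinarith [Real.sin_sq_add_cos_sq y, mul_le_mul_of_nonneg_right h2 hc, pow_pos hs 2]

/-- Intermediate value theorem on [π/2, π - 1/ω]: θ is below 2 at the left end, and near π it grows
at least like (π - y)^{-2}, hence exceeds ω at the right end. -/
theorem exists_theta_eq {ω : ℝ} (hω : 2 ≤ ω) : ∃ y ∈ Ioo (-Real.pi) Real.pi, theta y = ω := by
  have hp := Real.pi_gt_three
  have hω0 : 0 < ω := by linarith
  have hi : ω⁻¹ ≤ 1 / 2 := by rw [inv_le_comm₀ hω0 (by norm_num)]; linarith
  have hi0 : 0 < ω⁻¹ := inv_pos.2 hω0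
  have hle : Real.pi / 2 ≤ Real.pi - ω⁻¹ := by linarith
  have hcont : ContinuousOn theta (Icc (Real.pi / 2) (Real.pi - ω⁻¹)) := by
    have : ContinuousOn (fun y => (y - Real.sin y * Real.cos y) / Real.sin y ^ 2)
        (Icc (Real.pi / 2) (Real.pi - ω⁻¹)) := by
      refine ContinuousOn.div (by fun_prop) (by fun_prop) fun y hy => ?_
      exact pow_ne_zero _
        (Real.sin_pos_of_pos_of_lt_pi (by linarith [hy.1]) (by linarith [hy.2])).ne'
    exact this.congr fun y hy => theta_of_ne (by linarith [hy.1] : 0 < y).ne'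
  have htop : ω ≤ theta (Real.pi - ω⁻¹) := by
    rw [theta_of_ne (by linarith : 0 < Real.pi - ω⁻¹).ne', Real.sin_pi_sub, Real.cos_pi_sub]
    have hs : 0 < Real.sin ω⁻¹ := Real.sin_pos_of_pos_of_lt_pi hi0 (by linarith)
    have hs' := Real.sin_lt hi0
    have hc : 0 ≤ Real.cos ω⁻¹ := Real.cos_nonneg_of_mem_Icc ⟨by linarith, by linarith⟩
    rw [le_div_iff₀ (by positivity)]
    have h1 : Real.sin ω⁻¹ ^ 2 ≤ (ω⁻¹) ^ 2 := by gcongr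
    have h2 : ω * (ω⁻¹) ^ 2 = ω⁻¹ := by field_simp
    nlinarith [mul_le_mul_of_nonneg_left h1 hω0.le, mul_nonneg hs.le hc]
  obtain ⟨y, hy, h⟩ := intermediate_value_Icc hle hcont ⟨(theta_lt_two le_rfl).le.trans hω, htop⟩
  exact ⟨y, ⟨by linarith [hy.1], by linarith [hy.2]⟩, h⟩

theorem theta_yOmega {ω : ℝ} (hω : 2 ≤ ω) : theta (yOmega ω) = ω :=
  Function.invFunOn_eq (exists_theta_eq hω)

theorem yOmega_mem {ω : ℝ} (hω : 2 ≤ ω) : yOmega ω ∈ Ioo (Real.pi / 2) Real.pi := by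
  refine ⟨?_, (Function.invFunOn_mem (exists_theta_eq hω)).2⟩
  by_contra h
  have := theta_lt_two (not_lt.1 h)
  rw [theta_yOmega hω] at this
  linarith

/-- Jordan's inequality, with π/2 < 1.575 < 1.6. -/
theorem le_mul_sin {e : ℝ} (he : 0 < e) (he' : e < Real.pi / 2) : e ≤ 1.6 * Real.sin e := by
  have hjordan := Real.mul_le_sin he.le he'.le
  have h : 2 / Real.pi * e * Real.pi = 2 * e := by field_simp
  have h1 := mul_le_mul_of_nonneg_right hjordan Real.pi_pos.le
  have h2 := Real.sin_pos_of_pos_of_lt_pi he (by linarith)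
  have h3 := mul_le_mul_of_nonneg_left Real.pi_lt_d2.le h2.le
  linarith

/-- Combining e cos e ≤ sin e with cos e ≥ 1 - e²/2 gives e - sin e ≤ e³/2, so the difference of
squares is at most e⁴; then e² ≤ 1.6² sin² e. -/
theorem sq_sub_sin_sq_le {e : ℝ} (he : 0 < e) (he' : e < Real.pi / 2) :
    e ^ 2 - Real.sin e ^ 2 ≤ 2.56 * (e ^ 2 * Real.sin e ^ 2) := by
  have hces := mul_cos_le_sin he.le he'.le
  have hcos := mul_le_mul_of_nonneg_left (Real.one_sub_sq_div_two_le_cos (x := e)) he.le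
  have hse := Real.sin_lt he
  have hj := le_mul_sin he he'
  have hs : 0 < Real.sin e := Real.sin_pos_of_pos_of_lt_pi he (by linarith)
  set s := Real.sin e
  have h1 : (e - s) * (e + s) ≤ e ^ 3 / 2 * (2 * e) :=
    mul_le_mul (by linarith) (by linarith) (by positivity) (by positivity)
  have h2 : e ^ 2 ≤ (1.6 * s) ^ 2 := by gcongr
  have h3 := mul_le_mul_of_nonneg_left h2 (sq_nonneg e)
  linarith

/-- The hypothesis is θ(π - e) = r/R, so to leading order re² = πR, and q = √(πrR) is the geometric
mean of re and πR/e. The quantity splits as [πR/e - R(π-e) cos e / sin e] - [re + πR/e - 2q]; the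
first bracket lies in [0, 6R], the second in [0, 128R]. -/
theorem abs_sq_div_sin_sq_sub_le {R r e : ℝ} (hR : 0 < R) (he : 0 < e) (he' : e < Real.pi / 2)
    (hr : r * Real.sin e ^ 2 = R * (Real.pi - e + Real.sin e * Real.cos e)) :
    |R * ((Real.pi - e) / Real.sin e) ^ 2 + 2 * √(Real.pi * r * R) - Real.pi * r| ≤ 134 * R := by
  have hp := Real.pi_gt_three
  have hp' := Real.pi_lt_d2
  have hs : 0 < Real.sin e := Real.sin_pos_of_pos_of_lt_pi he (by linarith)
  have hse := Real.sin_lt he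
  have hc : 0 < Real.cos e := Real.cos_pos_of_mem_Ioo ⟨by linarith, he'⟩
  have hc1 := Real.cos_le_one e
  have hcos := Real.one_sub_sq_div_two_le_cos (x := e)
  have hces := mul_cos_le_sin he.le he'.le
  have hj := le_mul_sin he he'
  have hes := sq_sub_sin_sq_le he he'
  set s := Real.sin e
  set c := Real.cos e
  have hr0 : 0 < r := by
    have h1 : 0 < R * (Real.pi - e + s * c) :=
      mul_pos hR (by linarith [mul_pos hs hc])
    rw [← hr] at h1
    exact pos_of_mul_pos_left h1 (by positivity)
  set q := √(Real.pi * r * R) with hq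
  have hq0 : 0 ≤ q := Real.sqrt_nonneg _
  have hq2 : q ^ 2 = Real.pi * r * R := Real.sq_sqrt (by positivity)
  have hid : R * ((Real.pi - e) / s) ^ 2 = r * (Real.pi - e) - R * (Real.pi - e) * c / s := by
    have : r = R * (Real.pi - e + s * c) / s ^ 2 := by
      rw [eq_div_iff (by positivity)]; exact hr
    rw [this]
    field_simp
    ring
  -- This and the next inequality say |re² - πR| ≤ 16Re, the quantitative form of re² ≈ πR.
  have hb1 : r * e ^ 2 - Real.pi * R ≤ 16 * R * e := by
    have h1 : (r * e ^ 2 - Real.pi * R) * s ^ 2 ≤ 16 * R * e * s ^ 2 := by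
      have h2 : (r * e ^ 2 - Real.pi * R) * s ^ 2 =
          R * (e ^ 2 * (Real.pi - e + s * c) - Real.pi * s ^ 2) := by
        linear_combination e ^ 2 * hr
      rw [h2, mul_comm 16 R, mul_assoc, mul_assoc]
      refine mul_le_mul_of_nonneg_left ?_ hR.le
      have h3 : e ^ 2 * (Real.pi - e + s * c) ≤ e ^ 2 * Real.pi := by
        refine mul_le_mul_of_nonneg_left ?_ (by positivity)
        linarith [mul_le_mul_of_nonneg_left hc1 hs.le]
      have h4 : Real.pi * (e ^ 2 - s ^ 2) ≤ 3.15 * (2.56 * (e ^ 2 * s ^ 2)) := by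
        have h5 : s ^ 2 ≤ e ^ 2 := by gcongr
        exact mul_le_mul hp'.le hes (by linarith) (by norm_num)
      have h5 : e ^ 2 * s ^ 2 ≤ 1.6 * (e * s ^ 2) := by
        have h6 := mul_le_mul_of_nonneg_right (show e ≤ 1.6 by linarith)
          (show 0 ≤ e * s ^ 2 by positivity)
        linarith
      have h6 : 0 ≤ e * s ^ 2 := by positivity
      linarith
    exact le_of_mul_le_mul_right h1 (by positivity)
  have hb2 : -(16 * R * e) ≤ r * e ^ 2 - Real.pi * R := by
    have h1 : r * s ^ 2 ≤ r * e ^ 2 := by gcongr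
    have h2 : R * (Real.pi - e) ≤ r * s ^ 2 := by
      rw [hr]
      refine mul_le_mul_of_nonneg_left ?_ hR.le
      have := mul_pos hs hc
      linarith
    linarith [mul_pos hR he]
  -- The defect in the inequality of the means is a square divided by re + πR/e + 2q. The square is
  -- at most (16R)² and the divisor at least 2R, whence 128R.
  have hp1 : (r * e + Real.pi * R / e - 2 * q) * (r * e + Real.pi * R / e + 2 * q) =
      ((r * e ^ 2 - Real.pi * R) / e) ^ 2 := by
    have : (r * e + Real.pi * R / e - 2 * q) * (r * e + Real.pi * R / e + 2 * q) =
      (r * e + Real.pi * R / e) ^ 2 - 4 * q ^ 2 := by ring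
    rw [this, hq2]
    field_simp
    ring
  have hp2 : ((r * e ^ 2 - Real.pi * R) / e) ^ 2 ≤ (16 * R) ^ 2 := by
    refine sq_le_sq' ?_ ?_
    · rw [le_div_iff₀ he]; linarith
    · rw [div_le_iff₀ he]; linarith
  have hp3 : 2 * R ≤ Real.pi * R / e := by
    rw [le_div_iff₀ he]
    linarith [mul_le_mul_of_nonneg_left (show 2 * e ≤ Real.pi by linarith) hR.le]
  have hp4 : 2 * R ≤ r * e + Real.pi * R / e + 2 * q := by
    have : 0 < r * e := by positivity
    linarith
  rw [← hp1] at hp2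
  have hp5 : 0 ≤ (r * e + Real.pi * R / e - 2 * q) * (r * e + Real.pi * R / e + 2 * q) := by
    rw [hp1]; positivity
  clear hp1
  have hS0 : 0 < r * e + Real.pi * R / e + 2 * q := by linarith
  have hD0 : 0 ≤ r * e + Real.pi * R / e - 2 * q := nonneg_of_mul_nonneg_left hp5 hS0
  have hD1 : r * e + Real.pi * R / e - 2 * q ≤ 128 * R := by
    by_contra! h
    have h1 := mul_lt_mul h hp4 (by positivity) hD0
    linarith
  have hg1 : R * (Real.pi - e) * c / s ≤ Real.pi * R / e := by
    rw [div_le_div_iff₀ hs he]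
    have h1 : (Real.pi - e) * (e * c) ≤ Real.pi * s :=
      mul_le_mul (by linarith) hces (by positivity) (by linarith)
    have h2 := mul_le_mul_of_nonneg_left h1 hR.le
    linarith
  have hg2 : Real.pi * R / e - 6 * R ≤ R * (Real.pi - e) * c / s := by
    have h1 : Real.pi * R / e - 6 * R = R * (Real.pi - 6 * e) / e := by field_simp
    rw [h1, div_le_div_iff₀ he hs, mul_assoc, mul_assoc, mul_assoc]
    refine mul_le_mul_of_nonneg_left ?_ hR.le
    have h2 : s - e * c ≤ e ^ 3 / 2 := by
      have := mul_le_mul_of_nonneg_left hcos he.le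
      linarith
    have h3 : Real.pi * (s - e * c) ≤ 3.15 * (e ^ 3 / 2) :=
      mul_le_mul hp'.le h2 (by linarith) (by norm_num)
    have h4 : e ^ 3 ≤ 1.575 * e ^ 2 := by
      have := mul_le_mul_of_nonneg_right (show e ≤ 1.575 by linarith) (sq_nonneg e)
      linarith
    have h5 := mul_le_mul_of_nonneg_left hj he.le
    have h6 := mul_le_mul_of_nonneg_left hc1 (sq_nonneg e)
    linarith [sq_nonneg e]
  have h7 : r * (Real.pi - e) - R * (Real.pi - e) * c / s + 2 * q - Real.pi * r =
      Real.pi * R / e - R * (Real.pi - e) * c / s - (r * e + Real.pi * R / e - 2 * q) := by ring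
  rw [hid, h7, abs_le]
  constructor <;> linarith

/-- The distance to the origin near the centre of the group. -/
theorem abs_ccDist_sq_add_kappaParam_sub_le {n : ℕ} (x : EuclideanSpace ℝ (Fin (2 * n))) {t : ℝ}
    (ht : t ≠ 0) (hxt : 2 * (‖x‖ ^ 2 / 4) ≤ |t|) :
    |ccDist x t ^ 2 / 4 + kappaParam x t - Real.pi * abs t| ≤ 134 * (‖x‖ ^ 2 / 4) := by
  have hr : 0 < |t| := abs_pos.2 ht
  rcases eq_or_ne x 0 with rfl | hx
  · have h : (0 : ℝ) ≤ 4 * Real.pi * |t| := by positivity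
    rw [ccDist, if_neg ht, if_pos rfl, Real.sq_sqrt h]
    simp [kappaParam, mul_assoc]
  · have hR : 0 < ‖x‖ ^ 2 / 4 := by have := norm_pos_iff.2 hx; positivity
    have hω : 2 ≤ |t| / (‖x‖ ^ 2 / 4) := by rwa [le_div_iff₀ hR]
    rw [ccDist, if_neg ht, if_neg hx, kappaParam]
    obtain ⟨h1, h2⟩ := yOmega_mem hω
    have h3 := theta_yOmega hω
    set y := yOmega (|t| / (‖x‖ ^ 2 / 4))
    have hy : 0 < y := by linarith [Real.pi_pos]
    have hs : 0 < Real.sin y := Real.sin_pos_of_pos_of_lt_pi hy h2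
    rw [theta_of_ne hy.ne', div_eq_div_iff (by positivity) hR.ne'] at h3
    have key := abs_sq_div_sin_sq_sub_le (r := |t|) (e := Real.pi - y) hR (by linarith)
      (by linarith) (by rw [Real.sin_pi_sub, Real.cos_pi_sub, ← h3]; ring)
    rw [Real.sin_pi_sub, sub_sub_cancel] at key
    convert key using 3
    ring

/-! ### Bounds for the Bessel series, and the asymptotics with relative error. -/

theorem besselI_eq (m : ℕ) (z : ℝ) : besselI m z = (z / 2) ^ m * besselSeries m (z ^ 2 / 4) := by
  rw [besselI, besselSeries, ← tsum_mul_left]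
  refine tsum_congr fun k => ?_
  have h : Real.Gamma ((k : ℝ) + m + 1) = (k + m).factorial := by
    rw [← Real.Gamma_nat_eq_factorial]
    push_cast
    ring_nf
  rw [h, pow_add, pow_add, pow_mul, pow_mul, div_pow, div_pow]
  norm_num
  field_simp

theorem inv_factorial_le_besselSeries (m : ℕ) {a : ℝ} (ha : 0 ≤ a) :
    (m.factorial : ℝ)⁻¹ ≤ besselSeries m a := by
  have := (summable_besselSeries m a).le_tsum 0 fun k _ => by positivity
  simpa [besselSeries] using this

theorem besselSeries_le (m : ℕ) {a : ℝ} (ha : 0 ≤ a) :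
    besselSeries m a ≤ (m.factorial : ℝ)⁻¹ * Real.exp a := by
  have h1 : Real.exp a = ∑' k : ℕ, a ^ k / (k.factorial : ℝ) := by
    rw [Real.exp_eq_exp_ℝ, NormedSpace.exp_eq_tsum_div]
  rw [h1, ← tsum_mul_left, besselSeries]
  refine (summable_besselSeries m a).tsum_le_tsum (fun k => ?_)
    ((Real.summable_pow_div_factorial a).mul_left _)
  have h2 : (m.factorial : ℝ) ≤ (k + m).factorial := by
    exact_mod_cast Nat.factorial_le (Nat.le_add_left m k)
  rw [inv_mul_eq_div, div_div]
  gcongr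

/-- The main term contains the Bessel series, which is at least 1/m! for nonnegative argument;
dividing the absolute error by it therefore still gives O(1/|t|), uniformly for bounded κ. -/
theorem exists_radialDeriv_one_eq {n : ℕ} (hn : 0 < n) (k₁ k₂ : ℕ) (A : ℝ) :
    ∃ T : ℝ, 1 ≤ T ∧ ∃ K : ℝ, 0 ≤ K ∧ ∀ (x : EuclideanSpace ℝ (Fin (2 * n))) (t : ℝ),
      T ≤ |t| → kappaParam x t ^ 2 / 4 ≤ A → ∃ ε : ℂ, ‖ε‖ ≤ K / |t| ∧
        radialDeriv n 1 k₁ k₂ x t = (((-1) ^ k₂ * Real.pi ^ (k₁ + k₂) / 4 ^ n *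
          (|t| ^ (n + k₁ - 1) * Real.exp (-(Real.pi * |t|))) *
          besselSeries (n + k₁ - 1) (kappaParam x t ^ 2 / 4) : ℝ) : ℂ) * (1 + ε) := by
  obtain ⟨m, hm⟩ : ∃ m, n + k₁ = m + 1 := ⟨n + k₁ - 1, by omega⟩
  have hm' : n + k₁ - 1 = m := by omega
  obtain ⟨T, hT, K, hK, h⟩ := exists_norm_integral_integrand_sub_le hn k₁ k₂ hm A
  have hp := Real.pi_pos
  rw [hm']
  refine ⟨T, hT, K * m.factorial / (2 * Real.pi * Real.pi ^ (n + k₁ + k₂)), by positivity,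
    fun x t ht hκ => ?_⟩
  have hr : 0 < |t| := by linarith
  have hκ2 : kappaParam x t ^ 2 / 4 = Real.pi * |t| * (‖x‖ ^ 2 / 4) := by
    rw [kappaParam, mul_pow, Real.sq_sqrt (by positivity)]
    ring
  rw [hκ2] at hκ ⊢
  have h1 := h (‖x‖ ^ 2 / 4) |t| (by positivity) ht hκ
  rw [radialDeriv_one_eq hn]
  have hF := inv_factorial_le_besselSeries m (a := Real.pi * |t| * (‖x‖ ^ 2 / 4)) (by positivity)
  set F := besselSeries m (Real.pi * |t| * (‖x‖ ^ 2 / 4))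
  set J := ∫ l : ℝ, integrand n k₁ k₂ (‖x‖ ^ 2 / 4) |t| l
  set E := |t| ^ m * Real.exp (-(Real.pi * |t|)) with hE
  set X : ℝ := 2 * Real.pi * ((-1) ^ k₂ * Real.pi ^ (n + k₁ + k₂)) * E * F with hX
  have hE0 : 0 < E := by positivity
  have hfac : (0 : ℝ) < m.factorial := by exact_mod_cast m.factorial_pos
  have hF0 : 0 < F := lt_of_lt_of_le (by positivity) hF
  have hXabs : |X| = 2 * Real.pi * Real.pi ^ (n + k₁ + k₂) * E * F := by
    rw [hX]
    simp only [abs_mul, abs_pow, abs_neg, abs_one, one_pow, one_mul, abs_of_pos hp, abs_of_pos hE0,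
      abs_of_pos hF0, abs_two]
  have hX0 : X ≠ 0 := by rw [← abs_pos, hXabs]; positivity
  have hX0' : (X : ℂ) ≠ 0 := by exact_mod_cast hX0
  refine ⟨(J - X) / X, ?_, ?_⟩
  · rw [norm_div, Complex.norm_real, Real.norm_eq_abs, hXabs]
    refine (div_le_div_of_nonneg_right h1 (by positivity)).trans ?_
    rw [div_div, div_div, div_le_div_iff₀ (by positivity) (by positivity)]
    have h2 : 1 ≤ m.factorial * F := by
      rwa [inv_le_iff_one_le_mul₀' hfac] at hF
    calc K * E * (2 * Real.pi * Real.pi ^ (n + k₁ + k₂) * |t|)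
        = K * (E * (2 * Real.pi * Real.pi ^ (n + k₁ + k₂) * |t|)) * 1 := by ring
      _ ≤ K * (E * (2 * Real.pi * Real.pi ^ (n + k₁ + k₂) * |t|)) * (m.factorial * F) := by gcongr
      _ = _ := by ring
  · have h2 : (1 + (J - X) / X : ℂ) = J / X := by field_simp; ring
    rw [h2, mul_div_assoc', eq_div_iff hX0', hX]
    have hpc : (Real.pi : ℂ) ≠ 0 := by exact_mod_cast hp.ne'
    push_cast
    rw [mul_pow, add_assoc, pow_add]
    field_simp

theorem norm_exp_mul_one_add_sub_one_le {η : ℝ} (hη : |η| ≤ 1) (ε : ℂ) :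
    ‖(Real.exp η : ℂ) * (1 + ε) - 1‖ ≤ 2 * |η| + 3 * ‖ε‖ := by
  have h1 : ‖Complex.exp η - 1‖ ≤ 2 * ‖(η : ℂ)‖ := Complex.norm_exp_sub_one_le (by simpa using hη)
  rw [Complex.norm_real, Real.norm_eq_abs] at h1
  have h2 : ‖Complex.exp η‖ ≤ 3 := by
    have := norm_le_norm_sub_add (Complex.exp η) 1
    rw [norm_one] at this
    linarith
  rw [Complex.ofReal_exp]
  calc ‖Complex.exp η * (1 + ε) - 1‖ = ‖(Complex.exp η - 1) + Complex.exp η * ε‖ := by ring_nf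
    _ ≤ ‖Complex.exp η - 1‖ + ‖Complex.exp η‖ * ‖ε‖ := by
        rw [← norm_mul]; exact norm_add_le _ _
    _ ≤ _ := by gcongr

/-! ### The two asymptotic regimes. -/

theorem kappaParam_eq {n : ℕ} (x : EuclideanSpace ℝ (Fin (2 * n))) {t : ℝ} (ht : t ≠ 0) :
    kappaParam x t = 2 * Real.pi * |t| * deltaParam x t := by
  have hr : 0 < |t| := abs_pos.2 ht
  have hp := Real.pi_pos
  rw [kappaParam, deltaParam]
  have : Real.pi * |t| * (‖x‖ ^ 2 / 4) =
      (Real.pi * |t|) ^ 2 * (‖x‖ ^ 2 / 4 / (Real.pi * |t|)) := by field_simp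
  rw [this, Real.sqrt_mul (by positivity), Real.sqrt_sq (by positivity)]
  ring

theorem normSq_div_four_eq {n : ℕ} (x : EuclideanSpace ℝ (Fin (2 * n))) {t : ℝ} (ht : t ≠ 0) :
    ‖x‖ ^ 2 / 4 = kappaParam x t * deltaParam x t / 2 := by
  have hr : 0 < |t| := abs_pos.2 ht
  have hp := Real.pi_pos
  rw [kappaParam_eq x ht]
  have : deltaParam x t ^ 2 = ‖x‖ ^ 2 / 4 / (Real.pi * |t|) := Real.sq_sqrt (by positivity)
  have h2 : 2 * Real.pi * |t| * deltaParam x t * deltaParam x t / 2 =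
      Real.pi * |t| * deltaParam x t ^ 2 := by ring
  rw [h2, this]
  field_simp

/-- Since κ/2 = πδ|t|, the factor (κ/2)^m in the Bessel function turns (πδ)^{-m} into |t|^m. -/
theorem leadingIII_eq {n : ℕ} (k₁ k₂ : ℕ) (x : EuclideanSpace ℝ (Fin (2 * n))) {t : ℝ}
    (ht : t ≠ 0) (hδ : 0 < deltaParam x t) :
    leadingIII n k₁ k₂ x t = (-1) ^ k₂ * Real.pi ^ (k₁ + k₂) / 4 ^ n *
      (|t| ^ (n + k₁ - 1) * Real.exp (-(ccDist x t ^ 2 / 4 + kappaParam x t))) *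
      besselSeries (n + k₁ - 1) (kappaParam x t ^ 2 / 4) := by
  have hp := Real.pi_pos
  have h1 : kappaParam x t / 2 = Real.pi * deltaParam x t * |t| := by
    rw [kappaParam_eq x ht]; ring
  rw [leadingIII, besselI_eq, h1, neg_add, Real.exp_add, neg_div, mul_pow _ |t|]
  field_simp

theorem exists_radialDeriv_eq_leadingIII {n : ℕ} (hn : 0 < n) (k₁ k₂ : ℕ) {C : ℝ} (hC : 1 < C) :
    ∃ δ₀ : ℝ, 0 < δ₀ ∧ ∃ K : ℝ, ∀ (x : EuclideanSpace ℝ (Fin (2 * n))) (t : ℝ),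
      deltaParam x t ≤ δ₀ → 1 / C ≤ kappaParam x t → kappaParam x t ≤ C →
      ∃ ε : ℂ, ‖ε‖ ≤ K * deltaParam x t ∧
        radialDeriv n 1 k₁ k₂ x t = (leadingIII n k₁ k₂ x t : ℂ) * (1 + ε) := by
  obtain ⟨T, hT, K, hK, h⟩ := exists_radialDeriv_one_eq hn k₁ k₂ (C ^ 2 / 4)
  have hp := Real.pi_gt_three
  have hC0 : 0 < C := by linarith
  -- From κ = 2π|t|δ ≥ 1/C, the bound 2πCTδ ≤ 1 forces |t| ≥ T. From R = κδ/2 ≤ Cδ/2, the distance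
  -- error η is at most 134R ≤ 67Cδ ≤ 1. The final constant comes from 2|η| + 3|ε|, with 1/|t| ≤
  -- 2πCδ.
  refine ⟨1 / (2 * Real.pi * C * T + 67 * C + 1), by positivity, 134 * C + 6 * Real.pi * C * K,
    fun x t hδ hκ hκ' => ?_⟩
  have hκ0 : 0 < kappaParam x t := lt_of_lt_of_le (by positivity) hκ
  have ht : t ≠ 0 := by
    rintro rfl
    simp [kappaParam] at hκ0
  have hr : 0 < |t| := abs_pos.2 ht
  have hκe := kappaParam_eq x ht
  have hRe := normSq_div_four_eq x ht
  have hδ0 : 0 < deltaParam x t := by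
    refine pos_of_mul_pos_right (a := 2 * Real.pi * |t|) ?_ (by positivity)
    rwa [← hκe]
  have hdist := abs_ccDist_sq_add_kappaParam_sub_le x ht
  have hlead := leadingIII_eq k₁ k₂ x ht hδ0
  have h1 := h x t
  set δ := deltaParam x t
  set κ := kappaParam x t
  set R := ‖x‖ ^ 2 / 4
  rw [le_div_iff₀ (by positivity)] at hδ
  have hδ1 : δ * (2 * Real.pi * C * T) ≤ 1 := by
    nlinarith [mul_pos hδ0 hC0]
  have hδ2 : δ * (67 * C) ≤ 1 := by
    have : 0 < δ * (2 * Real.pi * C * T) := by positivity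
    nlinarith
  have hrδ : 1 ≤ 2 * Real.pi * C * (|t| * δ) := by
    rw [div_le_iff₀ hC0, hκe] at hκ
    linarith
  have htT : T ≤ |t| := by
    have h2 : (2 * Real.pi * C * δ) * T ≤ (2 * Real.pi * C * δ) * |t| := by linarith
    exact le_of_mul_le_mul_left h2 (by positivity)
  have hinv : 1 / |t| ≤ 2 * Real.pi * C * δ := by
    rw [div_le_iff₀ hr]; linarith
  have hRle : R ≤ C * δ / 2 := by
    rw [hRe]; gcongr
  obtain ⟨ε, hε, he⟩ := h1 htT (by gcongr)
  have hη := hdist (by linarith)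
  set η := ccDist x t ^ 2 / 4 + κ - Real.pi * |t| with hηdef
  have hη' : |η| ≤ 67 * C * δ := by linarith
  refine ⟨Real.exp η * (1 + ε) - 1, ?_, ?_⟩
  · refine (norm_exp_mul_one_add_sub_one_le (by linarith) ε).trans ?_
    have h3 : K / |t| ≤ K * (2 * Real.pi * C * δ) := by
      rw [div_eq_mul_one_div]; gcongr
    linarith
  · have h4 : Real.exp (-(Real.pi * |t|)) =
        Real.exp (-(ccDist x t ^ 2 / 4 + κ)) * Real.exp η := by
      rw [← Real.exp_add, hηdef]; ring_nf
    rw [he, hlead, h4]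
    push_cast
    ring

theorem exists_radialDeriv_eq_leadingIV {n : ℕ} (hn : 0 < n) (k₁ k₂ : ℕ) :
    ∃ κ₀ : ℝ, 0 < κ₀ ∧ ∃ T : ℝ, 0 < T ∧ ∃ K : ℝ,
      ∀ (x : EuclideanSpace ℝ (Fin (2 * n))) (t : ℝ), kappaParam x t ≤ κ₀ → T ≤ |t| →
        ∃ ε : ℂ, ‖ε‖ ≤ K * (1 / |t| + kappaParam x t) ∧
          radialDeriv n 1 k₁ k₂ x t = (leadingIV n k₁ k₂ x t : ℂ) * (1 + ε) := by
  obtain ⟨T, hT, K, hK, h⟩ := exists_radialDeriv_one_eq hn k₁ k₂ 1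
  have hp := Real.pi_gt_three
  -- κ ≤ 1/2 gives κ²/4 ≤ 1, the bound fed to the previous estimate, and R ≤ 1/|t|. With |t| ≥ 268
  -- the distance error 134/|t| + κ is at most 1. The final constant collects 2|η| + 3(κ + 2|ε|).
  refine ⟨1 / 2, by norm_num, T + 268, by linarith, 268 + 6 * K + 5, fun x t hκ ht => ?_⟩
  have hr : 0 < |t| := by linarith
  have ht0 : t ≠ 0 := abs_pos.1 hr
  have hκ0 : 0 ≤ kappaParam x t := by rw [kappaParam]; positivity
  have hκ2 : kappaParam x t ^ 2 / 4 = Real.pi * |t| * (‖x‖ ^ 2 / 4) := by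
    rw [kappaParam, mul_pow, Real.sq_sqrt (by positivity)]
    ring
  have hdist := abs_ccDist_sq_add_kappaParam_sub_le x ht0
  have hR0 : 0 ≤ ‖x‖ ^ 2 / 4 := by positivity
  obtain ⟨ε, hε, he⟩ := h x t (by linarith) (by nlinarith)
  rw [leadingIV]
  set m := n + k₁ - 1
  set κ := kappaParam x t
  set R := ‖x‖ ^ 2 / 4
  have hR : R ≤ 1 / |t| := by
    rw [le_div_iff₀ hr]
    nlinarith [mul_nonneg hR0 hr.le]
  have hi : 1 / |t| ≤ 1 / 268 := by gcongr; linarith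
  have hη := hdist (by linarith)
  set η := ccDist x t ^ 2 / 4 - Real.pi * |t| with hηdef
  have hη' : |η| ≤ 134 * (1 / |t|) + κ := by
    have h1 : η = (ccDist x t ^ 2 / 4 + κ - Real.pi * |t|) - κ := by rw [hηdef]; ring
    rw [h1]
    refine (abs_sub _ _).trans ?_
    rw [abs_of_nonneg hκ0]
    linarith
  have ha0 : 0 ≤ κ ^ 2 / 4 := by positivity
  have hfac : (0 : ℝ) < m.factorial := by exact_mod_cast m.factorial_pos
  have hF1 := inv_factorial_le_besselSeries m ha0
  have hF2 := besselSeries_le m ha0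
  set F := besselSeries m (κ ^ 2 / 4)
  -- The relative deviation of the Bessel series from its first term: 0 ≤ s ≤ e^{κ²/4} - 1 ≤ κ²/2 ≤
  -- κ.
  set s := m.factorial * F - 1 with hs
  have hs0 : 0 ≤ s := by
    rw [inv_le_iff_one_le_mul₀' hfac] at hF1
    linarith
  have hs1 : s ≤ κ := by
    have h1 : m.factorial * F ≤ Real.exp (κ ^ 2 / 4) := by
      rwa [← div_eq_inv_mul, le_div_iff₀' hfac] at hF2
    have h2 := Real.abs_exp_sub_one_le (x := κ ^ 2 / 4) (by rw [abs_of_nonneg ha0]; nlinarith)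
    rw [abs_of_nonneg ha0] at h2
    have h3 := le_abs_self (Real.exp (κ ^ 2 / 4) - 1)
    nlinarith
  set ε' : ℂ := (1 + s) * (1 + ε) - 1 with hε'
  have hε'n : ‖ε'‖ ≤ κ + 2 * ‖ε‖ := by
    have h1 : ε' = s + (1 + s) * ε := by rw [hε']; ring
    rw [h1]
    refine (norm_add_le _ _).trans ?_
    have h2 : ‖(1 + s : ℂ)‖ ≤ 2 := by
      refine (norm_add_le _ _).trans ?_
      rw [norm_one, Complex.norm_real, Real.norm_of_nonneg hs0]
      linarith
    rw [norm_mul, Complex.norm_real, Real.norm_of_nonneg hs0]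
    gcongr
  refine ⟨Real.exp η * (1 + ε') - 1, ?_, ?_⟩
  · refine (norm_exp_mul_one_add_sub_one_le (by linarith) ε').trans ?_
    have h3 : K / |t| = K * (1 / |t|) := by ring
    have h4 : 0 ≤ K * κ := by positivity
    have h5 : 0 ≤ 1 / |t| := by positivity
    rw [h3] at hε
    linarith
  · have h4 : Real.exp (-(Real.pi * |t|)) =
        Real.exp (-(ccDist x t ^ 2) / 4) * Real.exp η := by
      rw [← Real.exp_add, hηdef]; ring_nf
    have h5 : F = (1 + s) / m.factorial := by rw [hs]; field_simp; ring
    rw [he, h4, h5, hε']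
    push_cast
    field_simp
    ring

end Heisenberg

end

/-- Asymptotics of the radial partial derivatives of the time-one heat kernel on the Heisenberg
group, for `δ → 0⁺` with `κ ∈ [1/C, C]`, and for `κ → 0⁺`, `|t| → ∞`. The `O`-terms are factors
`1 + ε` with `ε` bounded by a constant multiple of `δ`, respectively of `1/|t| + κ`, uniformly in
`(x,t)`. -/
theorem theorem3p12 (n : ℕ) (hn : 0 < n) (k₁ k₂ : ℕ) :
    (∀ C : ℝ, 1 < C → ∃ δ₀ : ℝ, 0 < δ₀ ∧ ∃ K : ℝ,
      ∀ (x : EuclideanSpace ℝ (Fin (2 * n))) (t : ℝ),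
        Heisenberg.deltaParam x t ≤ δ₀ →
        1 / C ≤ Heisenberg.kappaParam x t → Heisenberg.kappaParam x t ≤ C →
        ∃ ε : ℂ, ‖ε‖ ≤ K * Heisenberg.deltaParam x t ∧
          Heisenberg.radialDeriv n 1 k₁ k₂ x t
            = (Heisenberg.leadingIII n k₁ k₂ x t : ℂ) * (1 + ε)) ∧
    (∃ κ₀ : ℝ, 0 < κ₀ ∧ ∃ T : ℝ, 0 < T ∧ ∃ K : ℝ,
      ∀ (x : EuclideanSpace ℝ (Fin (2 * n))) (t : ℝ),
        Heisenberg.kappaParam x t ≤ κ₀ → T ≤ |t| →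
        ∃ ε : ℂ, ‖ε‖ ≤ K * (1 / |t| + Heisenberg.kappaParam x t) ∧
          Heisenberg.radialDeriv n 1 k₁ k₂ x t
            = (Heisenberg.leadingIV n k₁ k₂ x t : ℂ) * (1 + ε)) :=
  ⟨fun _ hC => Heisenberg.exists_radialDeriv_eq_leadingIII hn k₁ k₂ hC,
    Heisenberg.exists_radialDeriv_eq_leadingIV hn k₁ k₂⟩
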